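/- **A bargaining game with ultimatums.** Two players bargain over a unit surplus in continuous time $t\ge 0$. Player $i\in\{1,2\}$ is, independently and with probability $z_i\in(0,1)$, *justified* in demanding $a_i$, and otherwise *unjustified*; here $a_1,a_2\in(0,1)$ and $D:=a_1+a_2-1>0$. Player $i$ has discount rate $r_i>0$. A justified player never concedes; a justified player 1 challenges at the (first) arrival of a Poisson process of rate $\gamma_1\ge 0$; a justified player 2 always sees a challenge. Challenging costs player 1 the amount $c_1D$ and seeing a challenge costs player 2 the amount $k_2D$. If player 2 yields to a challenge, the shares are $(a_1,1-a_1)$. If she sees it, an unjustified player $i$ facing a justified player $j$ gets $1-a_j$, and if both are unjustified player 1 gets $a_1$ (player 2 gets $1-a_1$) with probability $w_1$ and player 1 gets $1-a_2$ (player 2 gets $a_2$) with probability $1-w_1$. Assume $0\le w_1<c_1<1$ and $0<k_2<1-w_1$. A strategy of an unjustified player 1 is a pair $\Sigma_1=(F_1,G_1)$ of right-continuous increasing functions $[0,\infty)\to[0,1]$ with $F_1+G_1\le 1$ (the probabilities of having conceded, respectively challenged, by time $t$). A strategy of an unjustified player 2 is a pair $\Sigma_2=(F_2,q_2)$, where $F_2:[0,\infty)\to[0,1]$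 is right-continuous and increasing (probability of having conceded by time $t$) and $q_2:[0,\infty)\to[0,1]$ is measurable (probability of yielding to a challenge at time $t$). Put $F_i(0^-)=G_1(0^-)=0$. The utility of an unjustified player 1 from conceding, respectively challenging, at time $t$ is $$U_1(t)=(1-z_2)\int_{[0,t)}a_1e^{-r_1s}\,dF_2(s)+[1-(1-z_2)F_2(t)]e^{-r_1t}(1-a_2)+(1-z_2)[F_2(t)-F_2(t^-)]e^{-r_1t}\tfrac{a_1+1-a_2}{2},$$ $$V_1(t)=(1-z_2)\int_{[0,t]}a_1e^{-r_1s}\,dF_2(s)+[1-(1-z_2)F_2(t)]e^{-r_1t}(1-a_2-c_1D)+(1-z_2)[1-F_2(t)]e^{-r_1t}[(1-q_2(t))w_1+q_2(t)]D,$$ and that of an unjustified player 2 from conceding at time $t$ is $$\begin{aligned}U_2(t)=&\,(1-z_1)\int_{[0,t)}a_2e^{-r_2s}\,dF_1(s)+z_1\int_0^t[1-a_1-(1-q_2(s))k_2D]e^{-r_2s}\gamma_1e^{-\gamma_1s}\,ds\\&+(1-z_1)\int_{[0,t)}\{1-a_1+(1-q_2(s))(1-w_1-k_2)D\}e^{-r_2s}\,dG_1(s)\\&+e^{-r_2t}(1-a_1)\big[1-(1-z_1)F_1(t)-(1-z_1)G_1(t^-)-z_1(1-e^{-\gamma_1t})\big]\\&+(1-z_1)[F_1(t)-F_1(t^-)]e^{-r_2t}\tfrac{a_2+1-a_1}{2}.\end{aligned}$$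 The payoffs are $u_1(\Sigma_1,\Sigma_2)=\int_{[0,\infty)}U_1\,dF_1+\int_{[0,\infty)}V_1\,dG_1$ and $u_2(\Sigma_1,\Sigma_2)=\int_{[0,\infty)}U_2\,dF_2$. An equilibrium is a (Bayesian) Nash equilibrium: $\Sigma_1$ maximizes $u_1(\cdot,\Sigma_2)$ and $\Sigma_2$ maximizes $u_2(\Sigma_1,\cdot)$ over all strategies. Let $$\lambda_1:=\frac{r_2(1-a_1)}{D},\qquad \lambda_2:=\frac{r_1(1-a_2)}{D}.$$ **Proposition.** Let $(B^n)_{n\in\mathbb N}$ be a sequence of such games with the same $a_1,a_2,r_1,r_2,\gamma_1,c_1,k_2,w_1$ and with prior probabilities $z_1^n,z_2^n\in(0,1)$ such that $\lim_n z_1^n=\lim_n z_2^n=0$. For each $n$ let $(u_1^n,u_2^n)$ be the payoffs of the unjustified players in an equilibrium of $B^n$. Then $$\Big(\lim_{n\to\infty}u_1^n,\lim_{n\to\infty}u_2^n\Big)=\begin{cases}(1-a_2,a_2)&\text{if }\lambda_1<\gamma_1,\text{ or if }\gamma_1\le\lambda_1<\gamma_1+\lambda_2\text{ and }\lim_n z_1^n/z_2^n\text{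 exists in }(0,\infty),\\(a_1,1-a_1)&\text{if }\lambda_1>\gamma_1+\lambda_2\text{ and }\lim_n z_1^n/z_2^n\text{ exists in }(0,\infty).\end{cases}$$ -/

import Mathlib

open Filter Topology MeasureTheory Set

noncomputable section

/-- The parameters, other than the prior probabilities of being justified, of a bargaining game
over a unit surplus with ultimatum opportunities for player 1 and a single justified demand for
each player. -/
structure UltimatumBargaining where
  /-- demand of a justified player 1 -/
  a₁ : ℝ
  /-- demand of a justified player 2 -/
  a₂ : ℝ
  /-- discount rate of player 1 -/
  r₁ : ℝ
  /-- discount rate of player 2 -/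
  r₂ : ℝ
  /-- Poisson rate at which a justified player 1 challenges -/
  γ₁ : ℝ
  /-- challenging costs player 1 the amount `c₁ * D` -/
  c₁ : ℝ
  /-- seeing a challenge costs player 2 the amount `k₂ * D` -/
  k₂ : ℝ
  /-- probability that an unjustified challenger wins against an unjustified opponent -/
  w₁ : ℝ
  a₁_pos : 0 < a₁
  a₁_lt_one : a₁ < 1
  a₂_lt_one : a₂ < 1
  conflict : 1 - a₁ < a₂
  r₁_pos : 0 < r₁
  r₂_pos : 0 < r₂
  γ₁_nonneg : 0 ≤ γ₁
  w₁_nonneg : 0 ≤ w₁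
  w₁_lt_c₁ : w₁ < c₁
  c₁_lt_one : c₁ < 1
  k₂_pos : 0 < k₂
  k₂_lt : k₂ < 1 - w₁

/-- A strategy of an unjustified player 1: `F t` and `G t` are the probabilities of having conceded,
respectively challenged, by time `t` (inclusive). Both are right-continuous and increasing; they are
extended by `0` to negative times, so that `F 0` and `G 0` are the atoms at time `0`. -/
structure Strategy₁ where
  F : StieltjesFunction ℝ
  G : StieltjesFunction ℝ
  F_neg : ∀ t < 0, F t = 0
  G_neg : ∀ t < 0, G t = 0
  add_le_one : ∀ t, F t + G t ≤ 1

/-- A strategy of an unjustified player 2: `F t` is the probability of having conceded by time `t`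
(inclusive), and `q t` is the probability of yielding to a challenge made at time `t`. -/
structure Strategy₂ where
  F : StieltjesFunction ℝ
  q : ℝ → ℝ
  F_neg : ∀ t < 0, F t = 0
  F_le_one : ∀ t, F t ≤ 1
  q_measurable : Measurable q
  q_mem : ∀ t, q t ∈ Icc (0 : ℝ) 1

namespace UltimatumBargaining

variable (P : UltimatumBargaining)

/-- The amount of disagreement. -/
def D : ℝ := P.a₁ + P.a₂ - 1

/-- The rate `λ₁ = r₂ (1 - a₁) / D`. -/
def rate₁ : ℝ := P.r₂ * (1 - P.a₁) / P.D

/-- The rate `λ₂ = r₁ (1 - a₂) / D`. -/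
def rate₂ : ℝ := P.r₁ * (1 - P.a₂) / P.D

/-- Time-zero expected utility of an unjustified player 1 from conceding at time `t`, when player 2
is justified with probability `z₂`: player 2 conceded before `t`; or player 2 has not conceded by
`t`; or both concede at `t` (equal split). -/
def concedeUtility₁ (z₂ t : ℝ) (S₂ : Strategy₂) : ℝ :=
  (1 - z₂) * (∫ s in Ico 0 t, P.a₁ * Real.exp (-P.r₁ * s) ∂S₂.F.measure)
    + (1 - (1 - z₂) * S₂.F t) * Real.exp (-P.r₁ * t) * (1 - P.a₂)
    + (1 - z₂) * (S₂.F t - Function.leftLim S₂.F t) * Real.exp (-P.r₁ * t)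
        * ((P.a₁ + 1 - P.a₂) / 2)

/-- Time-zero expected utility of an unjustified player 1 from challenging at time `t`. A
simultaneous concession by player 2 takes precedence over the challenge. -/
def challengeUtility₁ (z₂ t : ℝ) (S₂ : Strategy₂) : ℝ :=
  (1 - z₂) * (∫ s in Icc 0 t, P.a₁ * Real.exp (-P.r₁ * s) ∂S₂.F.measure)
    + (1 - (1 - z₂) * S₂.F t) * Real.exp (-P.r₁ * t) * (1 - P.a₂ - P.c₁ * P.D)
    + (1 - z₂) * (1 - S₂.F t) * Real.exp (-P.r₁ * t)
        * (((1 - S₂.q t) * P.w₁ + S₂.q t) * P.D)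

/-- Expected utility of an unjustified player 1. -/
def payoff₁ (z₂ : ℝ) (S₁ : Strategy₁) (S₂ : Strategy₂) : ℝ :=
  (∫ t in Ici 0, P.concedeUtility₁ z₂ t S₂ ∂S₁.F.measure)
    + ∫ t in Ici 0, P.challengeUtility₁ z₂ t S₂ ∂S₁.G.measure

/-- Time-zero expected utility of an unjustified player 2 from conceding at time `t` and yielding to
challenges according to `q`, when player 1 is justified with probability `z₁`. The summands are:
an unjustified player 1 conceded before `t`; a justified player 1 challenged before `t`; an
unjustified player 1 challenged before `t`; player 1 has neither conceded by `t` nor challenged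
before `t`; both concede at `t` (equal split). -/
def concedeUtility₂ (z₁ t : ℝ) (q : ℝ → ℝ) (S₁ : Strategy₁) : ℝ :=
  (1 - z₁) * (∫ s in Ico 0 t, P.a₂ * Real.exp (-P.r₂ * s) ∂S₁.F.measure)
    + z₁ * (∫ s in Ico 0 t, (1 - P.a₁ - (1 - q s) * P.k₂ * P.D) * Real.exp (-P.r₂ * s)
        * (P.γ₁ * Real.exp (-P.γ₁ * s)) ∂volume)
    + (1 - z₁) * (∫ s in Ico 0 t, (1 - P.a₁ + (1 - q s) * (1 - P.w₁ - P.k₂) * P.D)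
        * Real.exp (-P.r₂ * s) ∂S₁.G.measure)
    + Real.exp (-P.r₂ * t) * (1 - P.a₁)
        * (1 - (1 - z₁) * S₁.F t - (1 - z₁) * Function.leftLim S₁.G t
            - z₁ * (1 - Real.exp (-P.γ₁ * t)))
    + (1 - z₁) * (S₁.F t - Function.leftLim S₁.F t) * Real.exp (-P.r₂ * t)
        * ((P.a₂ + 1 - P.a₁) / 2)

/-- Expected utility of an unjustified player 2. -/
def payoff₂ (z₁ : ℝ) (S₁ : Strategy₁) (S₂ : Strategy₂) : ℝ :=
  ∫ t in Ici 0, P.concedeUtility₂ z₁ t S₂.q S₁ ∂S₂.F.measure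

/-- `(S₁, S₂)` is a Bayesian Nash equilibrium of the game in which player `i` is justified with
prior probability `zᵢ`: no unjustified player gains by deviating to another strategy. -/
def IsEquilibrium (z₁ z₂ : ℝ) (S₁ : Strategy₁) (S₂ : Strategy₂) : Prop :=
  (∀ S₁' : Strategy₁, P.payoff₁ z₂ S₁' S₂ ≤ P.payoff₁ z₂ S₁ S₂) ∧
    ∀ S₂' : Strategy₂, P.payoff₂ z₁ S₁ S₂' ≤ P.payoff₂ z₁ S₁ S₂

/-- `(u₁, u₂)` is the pair of payoffs of the unjustified players in some equilibrium. -/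
def IsEquilibriumPayoff (z₁ z₂ u₁ u₂ : ℝ) : Prop :=
  ∃ (S₁ : Strategy₁) (S₂ : Strategy₂), P.IsEquilibrium z₁ z₂ S₁ S₂ ∧
    u₁ = P.payoff₁ z₂ S₁ S₂ ∧ u₂ = P.payoff₂ z₁ S₁ S₂

end UltimatumBargaining

end

/-! The game reduces to a war of attrition in which challenges are almost negligible. Since `w₁ <
c₁`, an unjustified player 1 challenges only at times when player 2 yields with positive
probability. At those times player 2 must not gain by seeing the challenge, so unjustified
challenges, weighted by her gain from seeing them, are dominated by justified ones weighted by her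
loss (`challenge_measure_le`). Total challenges are therefore atomless and of order `z₁`, and player
2's payoff can be computed as if she always yielded.

Conceding is then worth `1 - aⱼ` plus `D` times a waiting gain: discounted concessions received
minus a flow cost of delay. Both players are indifferent until a finite time `T` at which player 2
has surely conceded if unjustified (`exists_end_time`), and at most one of them concedes at time
`0`. Let `xᵢ` be the probability that player `i` concedes at time `0`; the payoffs are `1 - a₂ + D
x₂` and `1 - a₁ + D x₁`. Player 2 concedes at hazard rate `λ₂` until only her justified type is
left, so `z₂ exp(λ₂ T) = 1 - x₂`. Player 1 concedes at overall hazard rate `λ₁` while his justified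
type leaves at rate `γ₁`, so `1 - x₁` lies between `z₁ exp((λ₁ - γ₁) T)` and a constant times `z₁ (1
+ λ₁ ∫₀ᵀ exp((λ₁ - γ₁) x) dx)` (`equilibrium_structure`).

If `λ₁ < γ₁` the integral is bounded and `x₁ → 1`. Otherwise the priors are comparable and the
growth rates `λ₁ - γ₁` and `λ₂` compete: the equation for player 2 bounds `T`, which forces `x₁ → 1`
when `λ₂` is larger, and the lower bound for player 1 bounds `T`, which forces `x₂ → 1` when `λ₂` is
smaller. The `xᵢ` that tends to one makes the other one vanish. -/

noncomputable section

/-! ### Distribution functions on the half-line and their measures. -/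

namespace StieltjesFunction

variable {F : StieltjesFunction ℝ}

lemma leftLim_zero_of_neg (hF : ∀ t < 0, F t = 0) : Function.leftLim F 0 = 0 := by
  apply leftLim_eq_of_tendsto
  refine tendsto_const_nhds.congr' ?_
  filter_upwards [self_mem_nhdsWithin] with t ht using (hF t ht).symm

lemma nonneg_of_neg (hF : ∀ t < 0, F t = 0) (t : ℝ) : 0 ≤ F t := by
  have h := F.mono (min_le_left t (-1))
  rwa [hF _ (lt_of_le_of_lt (min_le_right t (-1)) (by norm_num))] at h

lemma measure_Iio_zero_of_neg (hF : ∀ t < 0, F t = 0) : F.measure (Iio 0) = 0 := by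
  have h : Tendsto F atBot (𝓝 0) := by
    refine tendsto_const_nhds.congr' ?_
    filter_upwards [eventually_lt_atBot 0] with t ht using (hF t ht).symm
  rw [F.measure_Iio h, leftLim_zero_of_neg hF]
  simp

lemma measure_restrict_Ici_zero (hF : ∀ t < 0, F t = 0) :
    F.measure.restrict (Ici 0) = F.measure := by
  apply Measure.restrict_eq_self_of_ae_mem
  rw [ae_iff]
  convert measure_Iio_zero_of_neg hF using 2
  ext t
  simp

lemma isFiniteMeasure_of_le_one (hF : ∀ t < 0, F t = 0) (h1 : ∀ t, F t ≤ 1) :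
    IsFiniteMeasure F.measure :=
  F.isFiniteMeasure_of_forall_abs_le (C := 1) fun t => by
    rw [abs_of_nonneg (nonneg_of_neg hF t)]
    exact h1 t

lemma measure_Icc_zero (hF : ∀ t < 0, F t = 0) (t : ℝ) :
    F.measure (Icc 0 t) = ENNReal.ofReal (F t) := by
  rw [F.measure_Icc, leftLim_zero_of_neg hF, sub_zero]

lemma measureReal_Icc_zero (hF : ∀ t < 0, F t = 0) (t : ℝ) :
    F.measure.real (Icc 0 t) = F t := by
  rw [measureReal_def, measure_Icc_zero hF, ENNReal.toReal_ofReal (nonneg_of_neg hF t)]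

/-- Total mass splits at any time into the mass up to it and the mass after it. -/
lemma measureReal_Ioi_eq [IsFiniteMeasure F.measure] (hF : ∀ t < 0, F t = 0) {t : ℝ} (ht : 0 ≤ t) :
    F.measure.real (Ioi t) = F.measure.real univ - F t := by
  have h2 : F.measure.real (Ici 0) = F.measure.real univ := by
    rw [← measure_restrict_Ici_zero hF]
    simp [measureReal_def]
  have h3 : F.measure.real (Icc 0 t ∪ Ioi t) = F.measure.real (Icc 0 t) + F.measure.real (Ioi t) :=
    measureReal_union (Set.disjoint_left.2 fun x hx hx' => not_lt.2 hx.2 hx') _root_.measurableSet_Ioi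
  rw [Icc_union_Ioi_eq_Ici ht, h2, measureReal_Icc_zero hF] at h3
  linarith

lemma leftLim_le_self (F : StieltjesFunction ℝ) (t : ℝ) : Function.leftLim F t ≤ F t :=
  F.mono.leftLim_le le_rfl

/-- An almost sure property holds at the times that carry an atom. -/
lemma of_ae_of_leftLim_lt {p : ℝ → Prop} (h : ∀ᵐ t ∂F.measure, p t) {t : ℝ}
    (ht : Function.leftLim F t < F t) : p t := by
  by_contra hp
  have h1 : F.measure {t} ≤ F.measure {x | ¬ p x} := measure_mono (by simpa using hp)
  rw [ae_iff.1 h, F.measure_singleton] at h1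
  simp at h1
  linarith

/-- An almost sure property holds at some time in each set of positive mass. -/
lemma exists_mem_of_ae {p : ℝ → Prop} (h : ∀ᵐ t ∂F.measure, p t) {s : Set ℝ}
    (hs : F.measure s ≠ 0) : ∃ t ∈ s, p t := by
  by_contra! hp
  exact hs (measure_mono_null (fun t ht => hp t ht) (ae_iff.1 h))

/-- The distribution function of the unit mass at `t`. -/
def unitStep (t : ℝ) : StieltjesFunction ℝ where
  toFun x := if t ≤ x then 1 else 0
  mono' x y hxy := by
    dsimp only
    split_ifs with h1 h2 <;> linarith
  right_continuous' x := by
    by_cases h : t ≤ x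
    · refine continuousWithinAt_const.congr (f := fun _ => (1 : ℝ)) (fun y hy => ?_) ?_
      · exact if_pos (h.trans hy)
      · exact if_pos h
    · have hx : ∀ᶠ y in 𝓝[Ici x] x, (if t ≤ y then (1 : ℝ) else 0) = 0 := by
        filter_upwards [nhdsWithin_le_nhds (Iio_mem_nhds (not_le.1 h))] with y hy
        exact if_neg (not_le.2 hy)
      exact (continuousWithinAt_const (b := (0 : ℝ))).congr_of_eventuallyEq hx (if_neg h)

lemma unitStep_apply (t x : ℝ) : unitStep t x = if t ≤ x then 1 else 0 := rfl

lemma unitStep_measure (t : ℝ) : (unitStep t).measure = Measure.dirac t := by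
  refine Measure.ext_of_Ioc _ _ fun a b hab => ?_
  rw [measure_Ioc, unitStep_apply, unitStep_apply, Measure.dirac_apply' _ measurableSet_Ioc]
  by_cases h1 : t ≤ b <;> by_cases h2 : t ≤ a <;>
    simp [indicator, h1, h2, not_lt.2, not_le.1]

/-- Integration by parts against an exponential. -/
lemma setIntegral_exp (hF : ∀ t < 0, F t = 0) (r : ℝ) {t : ℝ} (ht : 0 ≤ t) :
    ∫ s in Icc 0 t, Real.exp (-r * s) ∂F.measure =
      Real.exp (-r * t) * F t + ∫ x in (0 : ℝ)..t, Real.exp (-r * x) * (r * F x) := by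
  set μ := F.measure.restrict (Icc 0 t) with hμ
  set ν := (volume : Measure ℝ).restrict (Icc 0 t) with hν
  have : IsFiniteMeasure μ := ⟨by simp [hμ, F.measure_Icc]⟩
  have : IsFiniteMeasure ν := ⟨by simp [hν]⟩
  -- Fubini on the triangle `s ≤ x ≤ t`: integrating in `x` first gives the difference of
  -- exponentials, in `s` first the distribution function.
  let K : ℝ → ℝ → ℝ := fun s x => if s ≤ x then r * Real.exp (-r * x) else 0
  have hK : Integrable (Function.uncurry K) (μ.prod ν) := by
    have hm : Measurable (Function.uncurry K) :=
      Measurable.ite (measurableSet_le measurable_fst measurable_snd)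
        (by fun_prop) measurable_const
    obtain ⟨C, hC⟩ : ∃ C, ∀ x ∈ Icc (0 : ℝ) t, ‖r * Real.exp (-r * x)‖ ≤ C :=
      isCompact_Icc.exists_bound_of_continuousOn (by fun_prop)
    refine Integrable.of_bound hm.aestronglyMeasurable C ?_
    have h1 : ∀ᵐ p ∂(μ.prod ν), p ∈ Icc (0 : ℝ) t ×ˢ Icc (0 : ℝ) t := by
      rw [hμ, hν, Measure.prod_restrict]
      exact ae_restrict_mem (measurableSet_Icc.prod measurableSet_Icc)
    filter_upwards [h1] with p hp
    simp only [Function.uncurry, K]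
    split_ifs
    · exact hC _ hp.2
    · simpa using (norm_nonneg _).trans (hC _ hp.2)
  have hswap := integral_integral_swap hK
  have hL : ∫ s, ∫ x, K s x ∂ν ∂μ = ∫ s, (Real.exp (-r * s) - Real.exp (-r * t)) ∂μ := by
    refine setIntegral_congr_fun measurableSet_Icc fun s hs => ?_
    have h1 : (fun x => K s x) = (Ici s).indicator fun x => r * Real.exp (-r * x) := by
      ext x; simp [K, indicator]
    have h2 : Icc 0 t ∩ Ici s = Icc s t := by
      ext x; simp only [mem_inter_iff, mem_Icc, mem_Ici]
      exact ⟨fun h => ⟨h.2, h.1.2⟩, fun h => ⟨⟨hs.1.trans h.1, h.2⟩, h.1⟩⟩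
    have h3 : ∀ x ∈ uIcc s t,
        HasDerivAt (fun x => -Real.exp (-r * x)) (r * Real.exp (-r * x)) x := fun x _ => by
      have := (((hasDerivAt_id x).const_mul (-r)).exp).fun_neg
      simpa [mul_comm] using this
    rw [h1, hν, setIntegral_indicator measurableSet_Ici, h2, integral_Icc_eq_integral_Ioc,
      ← intervalIntegral.integral_of_le hs.2, intervalIntegral.integral_eq_sub_of_hasDerivAt h3
        (Continuous.intervalIntegrable (by fun_prop) _ _)]
    ring
  have hR : ∫ x, ∫ s, K s x ∂μ ∂ν = ∫ x, Real.exp (-r * x) * (r * F x) ∂ν := by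
    refine setIntegral_congr_fun measurableSet_Icc fun x hx => ?_
    have h1 : (fun s => K s x) = (Iic x).indicator fun _ => r * Real.exp (-r * x) := by
      ext s; simp [K, indicator]
    have h2 : Icc 0 t ∩ Iic x = Icc 0 x := by
      ext s; simp only [mem_inter_iff, mem_Icc, mem_Iic]
      exact ⟨fun h => ⟨h.1.1, h.2⟩, fun h => ⟨⟨h.1, h.2.trans hx.2⟩, h.2⟩⟩
    rw [h1, hμ, setIntegral_indicator measurableSet_Iic, h2, setIntegral_const,
      measureReal_Icc_zero hF, smul_eq_mul]
    ring
  have he : Integrable (fun s => Real.exp (-r * s)) μ :=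
    ((by fun_prop : Continuous fun s => Real.exp (-r * s)).continuousOn).integrableOn_Icc
  rw [hL, hR, integral_sub he (integrable_const _), integral_const, hν,
    integral_Icc_eq_integral_Ioc (μ := volume), ← intervalIntegral.integral_of_le ht] at hswap
  rw [← hswap, hμ, measureReal_restrict_apply_univ, measureReal_Icc_zero hF, smul_eq_mul]
  ring

/-- The integral over a half-open interval omits the atom at its right end. -/
lemma setIntegral_Ico_eq (F : StieltjesFunction ℝ) {f : ℝ → ℝ} (hf : Continuous f) {t : ℝ}
    (ht : 0 ≤ t) : ∫ s in Ico 0 t, f s ∂F.measure =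
      (∫ s in Icc 0 t, f s ∂F.measure) - (F t - Function.leftLim F t) * f t := by
  have h1 : IntegrableOn f (Icc 0 t) F.measure := hf.continuousOn.integrableOn_Icc
  rw [← Ico_union_right ht, setIntegral_union (by simp) (measurableSet_singleton t)
    (h1.mono_set Ico_subset_Icc_self) (h1.mono_set (by simpa using ht))]
  rw [Measure.restrict_singleton, integral_smul_measure, integral_dirac, F.measure_singleton,
    ENNReal.toReal_ofReal (sub_nonneg.2 (F.leftLim_le_self t)), smul_eq_mul]
  ring

end StieltjesFunction

/-! ### The abstract war of attrition. -/

/-- The gain, discounted at rate `r`, from waiting until just after time `t` in a war of attrition: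
`Φ` is the cumulative concession of the opponent, `S` her survival probability and `l` the flow
cost of waiting. -/
def waitingGain (r l : ℝ) (Φ S : ℝ → ℝ) (t : ℝ) : ℝ :=
  Real.exp (-r * t) * Φ t + ∫ x in (0 : ℝ)..t, Real.exp (-r * x) * (r * Φ x - l * S x)

section waitingGain

variable {r l : ℝ} {Φ S : ℝ → ℝ}

lemma waitingGain_zero : waitingGain r l Φ S 0 = Φ 0 := by
  simp [waitingGain]

lemma intervalIntegrable_exp_mul {f : ℝ → ℝ} (hf : ∀ a b, IntervalIntegrable f volume a b)
    (c a b : ℝ) : IntervalIntegrable (fun x => Real.exp (c * x) * f x) volume a b :=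
  (hf a b).continuousOn_mul (by fun_prop)

lemma intervalIntegrable_waiting (hΦ : Monotone Φ) (hS : Antitone S) (a b : ℝ) :
    IntervalIntegrable (fun x => r * Φ x - l * S x) volume a b :=
  (hΦ.intervalIntegrable.const_mul r).sub (hS.intervalIntegrable.const_mul l)

lemma integral_mul_exp (r s t : ℝ) :
    ∫ x in s..t, Real.exp (-r * x) * r = Real.exp (-r * s) - Real.exp (-r * t) := by
  have h3 : ∀ x ∈ uIcc s t,
      HasDerivAt (fun x => -Real.exp (-r * x)) (Real.exp (-r * x) * r) x := fun x _ => by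
    have := (((hasDerivAt_id x).const_mul (-r)).exp).fun_neg
    simpa using this
  rw [intervalIntegral.integral_eq_sub_of_hasDerivAt h3
    (Continuous.intervalIntegrable (by fun_prop) _ _)]
  ring

/-- Concessions are measured relative to `Φ s`, so that for `s ≤ t` the first two terms are
nonnegative and only the flow cost has the opposite sign. -/
lemma waitingGain_sub (hΦ : Monotone Φ) (hS : Antitone S) (s t : ℝ) :
    waitingGain r l Φ S t - waitingGain r l Φ S s =
      Real.exp (-r * t) * (Φ t - Φ s)
        + (∫ x in s..t, Real.exp (-r * x) * r * (Φ x - Φ s))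
        - l * ∫ x in s..t, Real.exp (-r * x) * S x := by
  have hi := intervalIntegrable_exp_mul (intervalIntegrable_waiting (r := r) (l := l) hΦ hS) (-r)
  have h1 := intervalIntegral.integral_interval_sub_left (hi 0 t) (hi 0 s)
  have h2 : ∫ x in s..t, Real.exp (-r * x) * (r * Φ x - l * S x) =
      (∫ x in s..t, Real.exp (-r * x) * r * (Φ x - Φ s))
        + Φ s * (Real.exp (-r * s) - Real.exp (-r * t))
        - l * ∫ x in s..t, Real.exp (-r * x) * S x := by
    rw [← integral_mul_exp, ← intervalIntegral.integral_const_mul,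
      ← intervalIntegral.integral_const_mul, ← intervalIntegral.integral_add,
      ← intervalIntegral.integral_sub]
    · congr 1; ext x; ring
    · refine IntervalIntegrable.add ?_ (Continuous.intervalIntegrable (by fun_prop) _ _)
      exact IntervalIntegrable.continuousOn_mul (hΦ.intervalIntegrable.sub (by simp)) (by fun_prop)
    · exact (intervalIntegrable_exp_mul (fun _ _ => hS.intervalIntegrable) (-r) s t).const_mul l
    · exact IntervalIntegrable.continuousOn_mul (hΦ.intervalIntegrable.sub (by simp)) (by fun_prop)
    · exact Continuous.intervalIntegrable (by fun_prop) _ _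
  have h3 : waitingGain r l Φ S t - waitingGain r l Φ S s =
      Real.exp (-r * t) * Φ t - Real.exp (-r * s) * Φ s
        + ((∫ x in (0 : ℝ)..t, Real.exp (-r * x) * (r * Φ x - l * S x))
        - ∫ x in (0 : ℝ)..s, Real.exp (-r * x) * (r * Φ x - l * S x)) := by
    rw [waitingGain, waitingGain]; ring
  rw [h3, h1, h2]
  ring

/-- Constancy is required only before `t`, which leaves room for a jump of `Φ` at `t` as the sole
compensation for waiting. -/
lemma waitingGain_sub_of_const (hΦ : Monotone Φ) (hS : Antitone S) {s t : ℝ} (hst : s ≤ t)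
    (hc : ∀ x ∈ Ico s t, Φ x = Φ s) :
    waitingGain r l Φ S t - waitingGain r l Φ S s =
      Real.exp (-r * t) * (Φ t - Φ s) - l * ∫ x in s..t, Real.exp (-r * x) * S x := by
  rw [waitingGain_sub hΦ hS, intervalIntegral.integral_of_le hst, ← integral_Ico_eq_integral_Ioc,
    setIntegral_eq_zero_of_forall_eq_zero, add_zero]
  intro x hx
  rw [hc x hx, sub_self, mul_zero]

lemma integral_exp_mul_pos (hS : Antitone S) (hpos : ∀ t, 0 < S t) {s t : ℝ} (hst : s < t) :
    0 < ∫ x in s..t, Real.exp (-r * x) * S x :=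
  intervalIntegral.intervalIntegral_pos_of_pos
    (intervalIntegrable_exp_mul (fun _ _ => hS.intervalIntegrable) (-r) s t)
    (fun x => mul_pos (Real.exp_pos _) (hpos x)) hst

/-- Waiting through an interval without concessions is costly. -/
lemma waitingGain_lt_of_const (hl : 0 < l) (hΦ : Monotone Φ) (hS : Antitone S)
    (hpos : ∀ t, 0 < S t) {s t : ℝ} (hst : s < t) (hc : ∀ x ∈ Icc s t, Φ x = Φ s) :
    waitingGain r l Φ S t < waitingGain r l Φ S s := by
  have h := waitingGain_sub_of_const (r := r) (l := l) hΦ hS hst.le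
    fun x hx => hc x (Ico_subset_Icc_self hx)
  rw [hc t (right_mem_Icc.2 hst.le), sub_self, mul_zero, zero_sub] at h
  have := mul_pos hl (integral_exp_mul_pos (r := r) hS hpos hst)
  linarith

/-- Concessions only help and delay costs at most `l` per unit of time: the gain may jump up but
never down. -/
lemma waitingGain_sub_ge (hr : 0 < r) (hl : 0 < l) (hΦ : Monotone Φ) (hS : Antitone S)
    (hS1 : ∀ t, 0 ≤ t → S t ≤ 1) {s t : ℝ} (hs : 0 ≤ s) (hst : s ≤ t) :
    -l * (t - s) ≤ waitingGain r l Φ S t - waitingGain r l Φ S s := by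
  have h1 : 0 ≤ ∫ x in s..t, Real.exp (-r * x) * r * (Φ x - Φ s) :=
    intervalIntegral.integral_nonneg hst fun x hx =>
      mul_nonneg (by positivity) (sub_nonneg.2 (hΦ hx.1))
  have h2 : ∫ x in s..t, Real.exp (-r * x) * S x ≤ ∫ _ in s..t, (1 : ℝ) := by
    refine intervalIntegral.integral_mono_on hst
      (intervalIntegrable_exp_mul (fun _ _ => hS.intervalIntegrable) (-r) s t) (by simp)
      fun x hx => ?_
    have hx0 : 0 ≤ x := hs.trans hx.1
    have h3 : Real.exp (-r * x) ≤ 1 := Real.exp_le_one_iff.2 (by nlinarith)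
    nlinarith [hS1 x hx0, Real.exp_pos (-r * x)]
  have h3 : 0 ≤ Real.exp (-r * t) * (Φ t - Φ s) :=
    mul_nonneg (Real.exp_pos _).le (sub_nonneg.2 (hΦ hst))
  rw [waitingGain_sub hΦ hS]
  simp only [intervalIntegral.integral_const, smul_eq_mul, mul_one] at h2
  nlinarith

lemma waitingGain_continuousWithinAt (hΦ : Monotone Φ) (hS : Antitone S)
    (hc : ∀ t, ContinuousWithinAt Φ (Ici t) t) (t : ℝ) :
    ContinuousWithinAt (waitingGain r l Φ S) (Ici t) t := by
  have h1 : Continuous fun u => ∫ x in (0 : ℝ)..u, Real.exp (-r * x) * (r * Φ x - l * S x) :=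
    intervalIntegral.continuous_primitive
      (intervalIntegrable_exp_mul (intervalIntegrable_waiting hΦ hS) (-r)) 0
  exact ((by fun_prop : Continuous fun t => Real.exp (-r * t)).continuousWithinAt.mul (hc t)).add
    h1.continuousWithinAt

/-- If the gain from waiting is constant, the opponent concedes at the overall hazard rate `l`. -/
lemma integral_exp_of_waitingGain_const {Γ : ℝ → ℝ} (hΦ : Monotone Φ) (hΓ : Continuous Γ)
    (hS : Antitone S) (hSe : ∀ t, S t = 1 - Φ t - Γ t) {T : ℝ} (hT : 0 ≤ T)
    (hJ : ∀ t ∈ Icc 0 T, waitingGain r l Φ S t = Φ 0) :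
    Real.exp (l * T) * (1 - Φ T) =
      1 - Φ 0 + ∫ x in (0 : ℝ)..T, Real.exp (l * x) * (l * Γ x) := by
  have hi := intervalIntegrable_exp_mul (intervalIntegrable_waiting (r := r) (l := l) hΦ hS) (-r)
  set p : ℝ → ℝ := fun u => ∫ x in (0 : ℝ)..u, Real.exp (-r * x) * (r * Φ x - l * S x) with hp
  have hpc : Continuous p := intervalIntegral.continuous_primitive hi 0
  -- Bootstrap: constancy expresses `Φ` through the primitive `p`, so `Φ` is continuous; then the
  -- integrand is continuous, `p` is differentiable, and `Φ' = l S`.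
  have hΦe : ∀ t ∈ Icc 0 T, Φ t = Real.exp (r * t) * (Φ 0 - p t) := fun t ht => by
    have h := hJ t ht
    rw [waitingGain] at h
    have h2 : Φ 0 - p t = Real.exp (-r * t) * Φ t := by simp only [hp]; linarith
    rw [h2, ← mul_assoc, ← Real.exp_add]
    simp
  have hΦc : ContinuousOn Φ (Icc 0 T) :=
    ContinuousOn.congr (f := fun t => Real.exp (r * t) * (Φ 0 - p t))
      (by fun_prop) hΦe
  have hΦd : ∀ t ∈ Ioo 0 T, HasDerivAt Φ (l * S t) t := fun t ht => by
    have hat : ContinuousAt Φ t := hΦc.continuousAt (Icc_mem_nhds ht.1 ht.2)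
    have hSat : ContinuousAt S t := by
      have : S = fun t => 1 - Φ t - Γ t := funext hSe
      rw [this]
      exact (continuousAt_const.sub hat).sub hΓ.continuousAt
    have hm : Measurable fun x => Real.exp (-r * x) * (r * Φ x - l * S x) := by
      have := hΦ.measurable
      have := hS.measurable
      fun_prop
    have hpd : HasDerivAt p (Real.exp (-r * t) * (r * Φ t - l * S t)) t :=
      intervalIntegral.integral_hasDerivAt_right (hi 0 t)
        hm.stronglyMeasurable.stronglyMeasurableAtFilter
        ((by fun_prop : Continuous fun t => Real.exp (-r * t)).continuousAt.mul
          ((hat.const_mul r).sub (hSat.const_mul l)))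
    have h1 := (((hasDerivAt_id t).const_mul r).exp).fun_mul (hpd.const_sub (Φ 0))
    have h2 : Φ =ᶠ[𝓝 t] fun t => Real.exp (r * t) * (Φ 0 - p t) := by
      filter_upwards [Icc_mem_nhds ht.1 ht.2] with x hx using hΦe x hx
    refine HasDerivAt.congr_of_eventuallyEq ?_ h2
    have h3 : Real.exp (r * t) * Real.exp (-r * t) = 1 := by
      rw [← Real.exp_add]; simp
    have h4 := hΦe t (Ioo_subset_Icc_self ht)
    refine h1.congr_deriv ?_
    simp only [id, mul_one]
    linear_combination -r * h4 - (r * Φ t - l * S t) * h3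
  have hd : ∀ t ∈ Ioo 0 T, HasDerivAt (fun x => Real.exp (l * x) * (1 - Φ x))
      (Real.exp (l * t) * (l * Γ t)) t := fun t ht => by
    have h1 := (((hasDerivAt_id t).const_mul l).exp).fun_mul ((hΦd t ht).const_sub 1)
    refine h1.congr_deriv ?_
    simp only [id, mul_one, hSe]
    ring
  rw [intervalIntegral.integral_eq_sub_of_hasDerivAt_of_le hT
    (ContinuousOn.mul (by fun_prop) (continuousOn_const.sub hΦc)) hd
    (Continuous.intervalIntegrable (by fun_prop) _ _)]
  simp

end waitingGain

/-- In a war of attrition, a player who may still concede after time `t₀` is indifferent at `t₀`.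
`A` and `B` are the concession distributions of the two players; `waitingGain r l (b * B) S` is the
payoff of the first player and `waitingGain r' l' (a * A) S'` the payoff of the second player. -/
lemma waitingGain_eq_of_mass_after {A B : StieltjesFunction ℝ} {a b r r' l l' m m' : ℝ}
    {S S' : ℝ → ℝ} (ha : 0 < a) (hb : 0 < b) (hl : 0 < l) (hl' : 0 < l')
    (hS : Antitone S) (hS' : Antitone S') (hSpos : ∀ t, 0 < S t) (hSpos' : ∀ t, 0 < S' t)
    (hle : ∀ t, 0 ≤ t → waitingGain r l (fun t => b * B t) S t ≤ m)
    (hle' : ∀ t, 0 ≤ t → waitingGain r' l' (fun t => a * A t) S' t ≤ m')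
    (hae : ∀ᵐ t ∂A.measure, waitingGain r l (fun t => b * B t) S t = m)
    (hae' : ∀ᵐ t ∂B.measure, waitingGain r' l' (fun t => a * A t) S' t = m')
    (hno : ∀ t, Function.leftLim A t < A t → ¬ Function.leftLim B t < B t)
    {t₀ : ℝ} (ht₀ : 0 ≤ t₀) (hmass : A.measure (Ioi t₀) ≠ 0) :
    waitingGain r l (fun t => b * B t) S t₀ = m := by
  set J := waitingGain r l (fun t => b * B t) S with hJ
  set J' := waitingGain r' l' (fun t => a * A t) S' with hJ'
  have hA : Monotone fun t => a * A t := A.mono.const_mul ha.le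
  have hB : Monotone fun t => b * B t := B.mono.const_mul hb.le
  by_contra hne
  have hlt : J t₀ < m := lt_of_le_of_ne (hle t₀ ht₀) hne
  obtain ⟨t₁, ht₁, hJt₁⟩ := A.exists_mem_of_ae hae hmass
  -- The first optimal time `β` from `t₀` on belongs to `K` by right-continuity. If `t₀ < β`, then
  -- `A` is flat on `[t₀, β)`, so waiting there is wasteful for the opponent and `B` is flat too.
  -- Only a jump of `B` can make `β` optimal again; the opponent is then optimal at `β`, which needs
  -- a jump of `A` there, contradicting `hno`.
  set K : Set ℝ := {t | t₀ ≤ t ∧ J t = m} with hK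
  have hKne : K.Nonempty := ⟨t₁, (mem_Ioi.1 ht₁).le, hJt₁⟩
  have hKbdd : BddBelow K := ⟨t₀, fun t ht => ht.1⟩
  set β := sInf K with hβ
  have ht₀β : t₀ ≤ β := le_csInf hKne fun t ht => ht.1
  have hJβ : J β = m := by
    by_contra hne'
    have hlt' : J β < m := lt_of_le_of_ne (hle β (ht₀.trans ht₀β)) hne'
    have hc : ContinuousWithinAt J (Ici β) β :=
      waitingGain_continuousWithinAt hB hS
        (fun t => continuousWithinAt_const.mul (B.right_continuous t)) β
    obtain ⟨u, hu, hu'⟩ := mem_nhdsGE_iff_exists_Ico_subset.1 (hc (Iio_mem_nhds hlt'))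
    obtain ⟨t, htK, htu⟩ := exists_lt_of_csInf_lt hKne (show sInf K < u from hu)
    exact (ne_of_lt (hu' ⟨csInf_le hKbdd htK, htu⟩)) htK.2
  have hβlt : t₀ < β := lt_of_le_of_ne ht₀β fun h => hne (h ▸ hJβ)
  have hJlt : ∀ t ∈ Ico t₀ β, J t ≠ m := fun t ht h => absurd (csInf_le hKbdd ⟨ht.1, h⟩)
    (not_le.2 ht.2)
  have hAc : ∀ t ∈ Ico t₀ β, A t = A t₀ := fun t ht => by
    by_contra h
    have h1 : A t₀ < A t := lt_of_le_of_ne (A.mono ht.1) (Ne.symm h)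
    obtain ⟨x, hx, hx'⟩ := A.exists_mem_of_ae hae (s := Ioc t₀ t)
      (by rw [A.measure_Ioc]; simpa using h1)
    exact hJlt x ⟨hx.1.le, hx.2.trans_lt ht.2⟩ hx'
  have hJ'lt : ∀ t ∈ Ioo t₀ β, J' t < m' := fun t ht =>
    (waitingGain_lt_of_const hl' hA hS' hSpos' ht.1 fun x hx => by
      simp only [hAc x ⟨hx.1, hx.2.trans_lt ht.2⟩]).trans_le (hle' t₀ ht₀)
  have hBc : ∀ t ∈ Ico t₀ β, B t = B t₀ := fun t ht => by
    by_contra h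
    have h1 : B t₀ < B t := lt_of_le_of_ne (B.mono ht.1) (Ne.symm h)
    obtain ⟨x, hx, hx'⟩ := B.exists_mem_of_ae hae' (s := Ioc t₀ t)
      (by rw [B.measure_Ioc]; simpa using h1)
    exact (hJ'lt x ⟨hx.1, hx.2.trans_lt ht.2⟩).ne hx'
  have hleft : ∀ H : StieltjesFunction ℝ, (∀ t ∈ Ico t₀ β, H t = H t₀) →
      Function.leftLim H β = H t₀ := fun H hH => by
    refine leftLim_eq_of_tendsto (tendsto_const_nhds.congr' ?_)
    filter_upwards [Ioo_mem_nhdsLT hβlt] with t ht using (hH t ⟨ht.1.le, ht.2⟩).symm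
  have hBjump : B t₀ < B β := by
    have h := waitingGain_sub_of_const (r := r) (l := l) hB hS hβlt.le
      fun x hx => by simp only [hBc x hx]
    have h1 := mul_pos hl (integral_exp_mul_pos (r := r) hS hSpos hβlt)
    have h2 : 0 < Real.exp (-r * β) * (b * B β - b * B t₀) := by
      simp only [← hJ] at h
      linarith
    have h3 := pos_of_mul_pos_right h2 (Real.exp_pos _).le
    nlinarith
  have hJ'β : J' β = m' := B.of_ae_of_leftLim_lt hae' (by rwa [hleft B hBc])
  have hAjump : A t₀ < A β := by
    have h := waitingGain_sub_of_const (r := r') (l := l') hA hS' hβlt.le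
      fun x hx => by simp only [hAc x hx]
    have h1 := mul_pos hl' (integral_exp_mul_pos (r := r') hS' hSpos' hβlt)
    have h2 : 0 < Real.exp (-r' * β) * (a * A β - a * A t₀) := by
      simp only [← hJ'] at h
      linarith [hle' t₀ ht₀]
    have h3 := pos_of_mul_pos_right h2 (Real.exp_pos _).le
    nlinarith
  exact hno β (by rwa [hleft A hAc]) (by rwa [hleft B hBc])

/-- A player who may still concede after time `t` waits for concessions of the opponent. -/
lemma measure_Ioi_ne_zero_of_opponent {A B : StieltjesFunction ℝ} {b r l m : ℝ} {S : ℝ → ℝ}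
    (hb : 0 < b) (hl : 0 < l) (hS : Antitone S) (hSpos : ∀ t, 0 < S t)
    (hle : ∀ t, 0 ≤ t → waitingGain r l (fun t => b * B t) S t ≤ m)
    (hae : ∀ᵐ t ∂A.measure, waitingGain r l (fun t => b * B t) S t = m)
    {t : ℝ} (ht : 0 ≤ t) (hmass : A.measure (Ioi t) ≠ 0) : B.measure (Ioi t) ≠ 0 := fun h0 => by
  obtain ⟨s, hs, hJ⟩ := A.exists_mem_of_ae hae hmass
  have h1 := waitingGain_lt_of_const (r := r) hl (B.mono.const_mul hb.le) hS hSpos (mem_Ioi.1 hs)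
    fun x hx => by
      have h2 : B.measure (Ioc t x) = 0 := measure_mono_null (fun y hy => hy.1) h0
      rw [B.measure_Ioc, ENNReal.ofReal_eq_zero] at h2
      rw [le_antisymm (sub_nonpos.1 h2) (B.mono hx.1)]
  exact absurd (hJ ▸ h1) (not_lt.2 (hle t ht))

/-- By `waitingGain_sub_ge` the gain cannot drop at `T`: from a time within `ε / l` of `T` it loses
at most `ε`. -/
lemma waitingGain_eq_at_end {r l m T : ℝ} {Φ S : ℝ → ℝ} (hr : 0 < r) (hl : 0 < l) (hΦ : Monotone Φ)
    (hS : Antitone S) (hS1 : ∀ t, 0 ≤ t → S t ≤ 1) (hT : 0 < T)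
    (hJ : ∀ t ∈ Ico 0 T, waitingGain r l Φ S t = m) (hle : waitingGain r l Φ S T ≤ m) :
    waitingGain r l Φ S T = m := by
  refine le_antisymm hle (le_of_forall_pos_le_add fun ε hε => ?_)
  have hs : max 0 (T - ε / l) < T := max_lt hT (by linarith [div_pos hε hl])
  have h := waitingGain_sub_ge hr hl hΦ hS hS1 (le_max_left 0 (T - ε / l)) hs.le
  rw [hJ _ ⟨le_max_left _ _, hs⟩] at h
  have h1 : l * (T - max 0 (T - ε / l)) ≤ l * (ε / l) :=
    mul_le_mul_of_nonneg_left (by linarith [le_max_right 0 (T - ε / l)]) hl.le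
  rw [mul_div_cancel₀ _ hl.ne'] at h1
  linarith

/-! ### Comparison of measures, and the arrival time of justified challenges. -/

lemma MeasureTheory.Measure.le_of_forall_setIntegral_le {α : Type*} [MeasurableSpace α]
    {μ ν : Measure α} {f : α → ℝ} (hf : Measurable f) (h0 : ∀ x, 0 ≤ f x)
    (hμ : Integrable f μ) (hν : Integrable f ν)
    (h : ∀ s, MeasurableSet s → ∫ x in s, f x ∂ν ≤ ∫ x in s, f x ∂μ)
    (hpos : ∀ᵐ x ∂ν, 0 < f x) : ν ≤ μ := by
  set g : α → ENNReal := fun x => ENNReal.ofReal (f x) with hg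
  have hgm : Measurable g := hf.ennreal_ofReal
  have h1 : ν.withDensity g ≤ μ.withDensity g := by
    refine Measure.le_intro fun s hs _ => ?_
    rw [withDensity_apply _ hs, withDensity_apply _ hs,
      ← ofReal_integral_eq_lintegral_ofReal hν.restrict (ae_of_all _ h0),
      ← ofReal_integral_eq_lintegral_ofReal hμ.restrict (ae_of_all _ h0)]
    exact ENNReal.ofReal_le_ofReal (h s hs)
  -- Dividing by `f` recovers `ν` exactly, as `f > 0` almost everywhere for `ν`; for `μ` it can only
  -- lose mass, where `f` vanishes.
  have h2 : (ν.withDensity g).withDensity g⁻¹ ≤ (μ.withDensity g).withDensity g⁻¹ := by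
    refine Measure.le_intro fun s hs _ => ?_
    rw [withDensity_apply _ hs, withDensity_apply _ hs]
    exact lintegral_mono' (Measure.restrict_mono le_rfl h1) le_rfl
  change (ν.withDensity g).withDensity (fun x => (g x)⁻¹) ≤ _ at h2
  rw [withDensity_inv_same hgm (by filter_upwards [hpos] with x hx using by simpa [hg] using hx)
    (by simp [hg])] at h2
  exact h2.trans (withDensity_inv_same_le hgm.aemeasurable)

lemma integrableOn_mul_exp (m : Measure ℝ) [IsLocallyFiniteMeasure m] {g : ℝ → ℝ}
    (hg : Measurable g) (hb : ∀ s, |g s| ≤ 1) (r t : ℝ) :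
    IntegrableOn (fun s => g s * Real.exp (-r * s)) (Ico 0 t) m := by
  have h1 : IntegrableOn (fun s => Real.exp (-r * s)) (Icc 0 t) m :=
    (by fun_prop : Continuous fun s => Real.exp (-r * s)).continuousOn.integrableOn_Icc
  exact (h1.mono_set Ico_subset_Icc_self).bdd_mul (c := 1) hg.aestronglyMeasurable
    (ae_of_all _ hb)

/-- The distribution function of the first arrival time of a Poisson process of rate `γ`. -/
def arrivalDistribution (γ : ℝ) (hγ : 0 ≤ γ) : StieltjesFunction ℝ where
  toFun x := 1 - Real.exp (-γ * max x 0)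
  mono' x y hxy := by
    have : γ * max x 0 ≤ γ * max y 0 := mul_le_mul_of_nonneg_left (max_le_max_right 0 hxy) hγ
    have := Real.exp_le_exp.2 (show -γ * max y 0 ≤ -γ * max x 0 by linarith)
    dsimp only
    linarith
  right_continuous' x := (by fun_prop : Continuous fun x : ℝ =>
    1 - Real.exp (-γ * max x 0)).continuousWithinAt

section arrival

variable {γ : ℝ} (hγ : 0 ≤ γ)

lemma arrivalDistribution_of_nonneg {x : ℝ} (hx : 0 ≤ x) :
    arrivalDistribution γ hγ x = 1 - Real.exp (-γ * x) := by
  change 1 - Real.exp (-γ * max x 0) = _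
  rw [max_eq_left hx]

lemma arrivalDistribution_of_neg : ∀ x < 0, arrivalDistribution γ hγ x = 0 := fun x hx => by
  change 1 - Real.exp (-γ * max x 0) = _
  simp [max_eq_right hx.le]

lemma arrivalDistribution_continuous : Continuous (arrivalDistribution γ hγ) :=
  (by fun_prop : Continuous fun x : ℝ => 1 - Real.exp (-γ * max x 0))

lemma arrivalDistribution_measure : (arrivalDistribution γ hγ).measure =
    (volume.restrict (Ioi 0)).withDensity fun s => ENNReal.ofReal (γ * Real.exp (-γ * s)) := by
  refine Measure.ext_of_Ioc _ _ fun a b hab => ?_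
  have h1 : (Ioc a b ∩ Ioi 0 : Set ℝ) = Ioc (max a 0) (max b 0) := by
    rw [Ioc_inter_Ioi]
    rcases le_total b 0 with h | h
    · rw [max_eq_right h, max_eq_right (hab.le.trans h), Ioc_self, Ioc_eq_empty (not_lt.2 h)]
    · rw [max_eq_left h]
  have h2 : max a 0 ≤ max b 0 := max_le_max_right 0 hab.le
  rw [StieltjesFunction.measure_Ioc, withDensity_apply _ measurableSet_Ioc,
    Measure.restrict_restrict measurableSet_Ioc, h1, ← ofReal_integral_eq_lintegral_ofReal
      (Continuous.integrableOn_Ioc (by fun_prop)) (ae_of_all _ fun x => by positivity),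
    ← intervalIntegral.integral_of_le h2]
  simp_rw [mul_comm γ]
  rw [integral_mul_exp]
  congr 1
  change (1 - Real.exp (-γ * max b 0)) - (1 - Real.exp (-γ * max a 0)) = _
  ring

/-- Puts justified challenges on the same footing as unjustified ones, so that one integration by
parts serves both. -/
lemma setIntegral_arrivalDistribution (f : ℝ → ℝ) (t : ℝ) :
    ∫ s in Ico 0 t, f s ∂(arrivalDistribution γ hγ).measure =
      ∫ s in Ico 0 t, f s * (γ * Real.exp (-γ * s)) := by
  rw [arrivalDistribution_measure, Measure.restrict_congr_set Ioi_ae_eq_Ici,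
    restrict_withDensity measurableSet_Ico, Measure.restrict_restrict measurableSet_Ico,
    inter_eq_left.2 fun x hx => hx.1,
    integral_withDensity_eq_integral_toReal_smul (by fun_prop) (by simp)]
  congr 1
  ext s
  rw [ENNReal.toReal_ofReal (by positivity), smul_eq_mul, mul_comm]

end arrival

/-! ### Utilities expressed through waiting gains. -/

/-- The waiting gain, when the flow cost of waiting is `r * c / d`, in terms of cumulative
concessions `Φ` and cumulative challenges `Γ`. -/
lemma mul_waitingGain {r c d : ℝ} {Φ Γ : ℝ → ℝ} (hd : d ≠ 0) (hΦ : Monotone Φ) (hΓ : Monotone Γ)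
    (t : ℝ) : d * waitingGain r (r * c / d) Φ (fun t => 1 - Φ t - Γ t) t =
      d * Real.exp (-r * t) * Φ t
        + (d + c) * (∫ x in (0 : ℝ)..t, Real.exp (-r * x) * (r * Φ x))
        + c * (∫ x in (0 : ℝ)..t, Real.exp (-r * x) * (r * Γ x))
        - c * (1 - Real.exp (-r * t)) := by
  have h0 := integral_mul_exp r 0 t
  rw [mul_zero, Real.exp_zero] at h0
  rw [← h0, waitingGain, mul_add, ← intervalIntegral.integral_const_mul,
    ← intervalIntegral.integral_const_mul, ← intervalIntegral.integral_const_mul,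
    ← intervalIntegral.integral_const_mul, mul_assoc, add_assoc, add_sub_assoc, add_right_inj,
    ← intervalIntegral.integral_add, ← intervalIntegral.integral_sub]
  · congr 1
    ext x
    field_simp
    ring
  · refine IntervalIntegrable.add ?_ ?_ <;> refine IntervalIntegrable.const_mul ?_ _
    · exact intervalIntegrable_exp_mul (fun _ _ => hΦ.intervalIntegrable.const_mul r) _ _ _
    · exact intervalIntegrable_exp_mul (fun _ _ => hΓ.intervalIntegrable.const_mul r) _ _ _
  · exact Continuous.intervalIntegrable (by fun_prop) _ _
  · refine IntervalIntegrable.const_mul ?_ _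
    exact intervalIntegrable_exp_mul (fun _ _ => hΦ.intervalIntegrable.const_mul r) _ _ _
  · refine IntervalIntegrable.const_mul ?_ _
    exact intervalIntegrable_exp_mul (fun _ _ => hΓ.intervalIntegrable.const_mul r) _ _ _

namespace UltimatumBargaining

variable (P : UltimatumBargaining)

lemma D_pos : 0 < P.D := by
  have := P.conflict
  rw [D]; linarith

lemma rate₁_pos : 0 < P.rate₁ :=
  div_pos (mul_pos P.r₂_pos (sub_pos.2 P.a₁_lt_one)) P.D_pos

lemma rate₂_pos : 0 < P.rate₂ :=
  div_pos (mul_pos P.r₁_pos (sub_pos.2 P.a₂_lt_one)) P.D_pos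

/-- The probability that player 1 has challenged by time `t`. -/
def challenged₁ (z₁ : ℝ) (S₁ : Strategy₁) (t : ℝ) : ℝ :=
  (1 - z₁) * S₁.G t + z₁ * arrivalDistribution P.γ₁ P.γ₁_nonneg t

/-- The probability that player 1 has neither conceded nor challenged by time `t`. -/
def survival₁ (z₁ : ℝ) (S₁ : Strategy₁) (t : ℝ) : ℝ :=
  1 - (1 - z₁) * S₁.F t - P.challenged₁ z₁ S₁ t

/-- The normalized gain of player 1 from waiting until just after time `t`. -/
def gain₁ (z₂ : ℝ) (S₂ : Strategy₂) : ℝ → ℝ :=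
  waitingGain P.r₁ P.rate₂ (fun t => (1 - z₂) * S₂.F t) (fun t => 1 - (1 - z₂) * S₂.F t - 0)

/-- The normalized gain of player 2 from waiting until just after time `t`, if she yields to
challenges. -/
def gain₂ (z₁ : ℝ) (S₁ : Strategy₁) : ℝ → ℝ :=
  waitingGain P.r₂ P.rate₁ (fun t => (1 - z₁) * S₁.F t) (P.survival₁ z₁ S₁)

variable {P} {z₁ z₂ t : ℝ} {S₁ : Strategy₁} {S₂ : Strategy₂}

lemma challenged₁_mono (h0 : 0 ≤ z₁) (h1 : z₁ ≤ 1) : Monotone (P.challenged₁ z₁ S₁) :=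
  (S₁.G.mono.const_mul (sub_nonneg.2 h1)).add (StieltjesFunction.mono _ |>.const_mul h0)

lemma survival₁_anti (h0 : 0 ≤ z₁) (h1 : z₁ ≤ 1) : Antitone (P.survival₁ z₁ S₁) := fun s t hst => by
  have h2 := mul_le_mul_of_nonneg_left (S₁.F.mono hst) (sub_nonneg.2 h1)
  have h3 := challenged₁_mono (P := P) (S₁ := S₁) h0 h1 hst
  rw [survival₁, survival₁]
  linarith

lemma setIntegral_Icc_const_mul_exp {F : StieltjesFunction ℝ} (hF : ∀ t < 0, F t = 0) (c r : ℝ)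
    (ht : 0 ≤ t) : ∫ s in Icc 0 t, c * Real.exp (-r * s) ∂F.measure =
      c * (Real.exp (-r * t) * F t + ∫ x in (0 : ℝ)..t, Real.exp (-r * x) * (r * F x)) := by
  rw [integral_const_mul, F.setIntegral_exp hF r ht]

lemma setIntegral_Ico_const_mul_exp {F : StieltjesFunction ℝ} (hF : ∀ t < 0, F t = 0) (c r : ℝ)
    (ht : 0 ≤ t) : ∫ s in Ico 0 t, c * Real.exp (-r * s) ∂F.measure =
      c * (Real.exp (-r * t) * Function.leftLim F t
        + ∫ x in (0 : ℝ)..t, Real.exp (-r * x) * (r * F x)) := by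
  rw [F.setIntegral_Ico_eq (by fun_prop) ht, setIntegral_Icc_const_mul_exp hF c r ht]
  ring

lemma integral_exp_mul_const_mul (c r a b : ℝ) (f : ℝ → ℝ) :
    ∫ x in a..b, Real.exp (-r * x) * (r * (c * f x)) =
      c * ∫ x in a..b, Real.exp (-r * x) * (r * f x) := by
  rw [← intervalIntegral.integral_const_mul]
  congr 1; ext x; ring

lemma D_mul_gain₁ (h1 : z₂ ≤ 1) (t : ℝ) : P.D * P.gain₁ z₂ S₂ t =
    P.D * Real.exp (-P.r₁ * t) * ((1 - z₂) * S₂.F t)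
      + P.a₁ * ((1 - z₂) * ∫ x in (0 : ℝ)..t, Real.exp (-P.r₁ * x) * (P.r₁ * S₂.F x))
      - (1 - P.a₂) * (1 - Real.exp (-P.r₁ * t)) := by
  rw [gain₁, rate₂, mul_waitingGain P.D_pos.ne' (S₂.F.mono.const_mul (sub_nonneg.2 h1))
    monotone_const, integral_exp_mul_const_mul, D]
  simp only [mul_zero, intervalIntegral.integral_zero]
  ring

/-- The gain counts an atom of player 2 at `t` in full, whereas the equal split yields `D / 2` less
than being conceded to. -/
lemma concedeUtility₁_eq (h1 : z₂ ≤ 1) (ht : 0 ≤ t) : P.concedeUtility₁ z₂ t S₂ =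
    1 - P.a₂ + P.D * P.gain₁ z₂ S₂ t
      - P.D / 2 * (1 - z₂) * Real.exp (-P.r₁ * t) * (S₂.F t - Function.leftLim S₂.F t) := by
  rw [D_mul_gain₁ h1, concedeUtility₁, setIntegral_Ico_const_mul_exp S₂.F_neg _ _ ht, D]
  ring

/-- The last bracket is the net cost of challenging in units of `D`; ties cost nothing because a
concession takes precedence. -/
lemma challengeUtility₁_eq (h1 : z₂ ≤ 1) (ht : 0 ≤ t) : P.challengeUtility₁ z₂ t S₂ =
    1 - P.a₂ + P.D * P.gain₁ z₂ S₂ t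
      - P.D * Real.exp (-P.r₁ * t) * (P.c₁ * (1 - (1 - z₂) * S₂.F t)
        - (1 - z₂) * (1 - S₂.F t) * ((1 - S₂.q t) * P.w₁ + S₂.q t)) := by
  rw [D_mul_gain₁ h1, challengeUtility₁, setIntegral_Icc_const_mul_exp S₂.F_neg _ _ ht, D]
  ring

lemma D_mul_gain₂ (h0 : 0 ≤ z₁) (h1 : z₁ ≤ 1) (t : ℝ) : P.D * P.gain₂ z₁ S₁ t =
    P.D * Real.exp (-P.r₂ * t) * ((1 - z₁) * S₁.F t)
      + P.a₂ * ((1 - z₁) * ∫ x in (0 : ℝ)..t, Real.exp (-P.r₂ * x) * (P.r₂ * S₁.F x))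
      + (1 - P.a₁) * (∫ x in (0 : ℝ)..t, Real.exp (-P.r₂ * x) * (P.r₂ * P.challenged₁ z₁ S₁ x))
      - (1 - P.a₁) * (1 - Real.exp (-P.r₂ * t)) := by
  rw [gain₂, rate₁]
  unfold survival₁
  rw [mul_waitingGain P.D_pos.ne' (S₁.F.mono.const_mul (sub_nonneg.2 h1))
    (challenged₁_mono h0 h1), integral_exp_mul_const_mul, D]
  ring

lemma integral_challenged₁ (t : ℝ) :
    ∫ x in (0 : ℝ)..t, Real.exp (-P.r₂ * x) * (P.r₂ * P.challenged₁ z₁ S₁ x) =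
      (1 - z₁) * (∫ x in (0 : ℝ)..t, Real.exp (-P.r₂ * x) * (P.r₂ * S₁.G x))
      + z₁ * ∫ x in (0 : ℝ)..t, Real.exp (-P.r₂ * x)
          * (P.r₂ * arrivalDistribution P.γ₁ P.γ₁_nonneg x) := by
  rw [← integral_exp_mul_const_mul, ← integral_exp_mul_const_mul, ← intervalIntegral.integral_add]
  · congr 1; ext x; rw [challenged₁]; ring
  · exact intervalIntegrable_exp_mul
      (fun _ _ => (S₁.G.mono.intervalIntegrable.const_mul _).const_mul _) _ _ _
  · exact intervalIntegrable_exp_mul (fun _ _ =>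
      ((StieltjesFunction.mono _).intervalIntegrable.const_mul _).const_mul _) _ _ _

/-- The utility of player 2 if she yields to all challenges. -/
lemma concedeUtility₂_one_eq (h0 : 0 ≤ z₁) (h1 : z₁ ≤ 1) (ht : 0 ≤ t) :
    P.concedeUtility₂ z₁ t (fun _ => 1) S₁ =
      1 - P.a₁ + P.D * P.gain₂ z₁ S₁ t
        - P.D / 2 * (1 - z₁) * Real.exp (-P.r₂ * t) * (S₁.F t - Function.leftLim S₁.F t) := by
  have hH : ∫ s in Ico 0 t, (1 - P.a₁) * Real.exp (-P.r₂ * s) * (P.γ₁ * Real.exp (-P.γ₁ * s)) =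
      (1 - P.a₁) * (Real.exp (-P.r₂ * t) * (1 - Real.exp (-P.γ₁ * t))
        + ∫ x in (0 : ℝ)..t, Real.exp (-P.r₂ * x)
          * (P.r₂ * arrivalDistribution P.γ₁ P.γ₁_nonneg x)) := by
    rw [← setIntegral_arrivalDistribution P.γ₁_nonneg,
      setIntegral_Ico_const_mul_exp (arrivalDistribution_of_neg _) _ _ ht,
      ← arrivalDistribution_of_nonneg P.γ₁_nonneg ht]
    congr 4
    exact (arrivalDistribution_continuous P.γ₁_nonneg).continuousWithinAt.leftLim_eq
  rw [D_mul_gain₂ h0 h1, concedeUtility₂, integral_challenged₁,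
    setIntegral_Ico_const_mul_exp S₁.F_neg _ _ ht]
  simp only [sub_self, zero_mul, sub_zero, add_zero]
  rw [hH, setIntegral_Ico_const_mul_exp S₁.G_neg _ _ ht, D]
  ring

/-- Relative to yielding, seeing a challenge gains `(1 - w₁ - k₂) D` against an unjustified
challenger and loses `k₂ D` against a justified one. -/
lemma concedeUtility₂_eq_add {q : ℝ → ℝ} (hqm : Measurable q) (hq : ∀ t, q t ∈ Icc (0 : ℝ) 1) :
    P.concedeUtility₂ z₁ t q S₁ = P.concedeUtility₂ z₁ t (fun _ => 1) S₁
      + P.D * ((1 - P.w₁ - P.k₂) * (1 - z₁)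
            * (∫ s in Ico 0 t, (1 - q s) * Real.exp (-P.r₂ * s) ∂S₁.G.measure)
        - P.k₂ * z₁ * ∫ s in Ico 0 t, (1 - q s) * Real.exp (-P.r₂ * s)
            ∂(arrivalDistribution P.γ₁ P.γ₁_nonneg).measure) := by
  have hi : ∀ m : Measure ℝ, IsLocallyFiniteMeasure m →
      IntegrableOn (fun s => (1 - q s) * Real.exp (-P.r₂ * s)) (Ico 0 t) m := fun m _ =>
    integrableOn_mul_exp m (g := fun s => 1 - q s) (measurable_const.sub hqm)
      (fun s => abs_le.2 ⟨by linarith [(hq s).2], by linarith [(hq s).1]⟩) _ _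
  have he : ∀ m : Measure ℝ, IsLocallyFiniteMeasure m →
      IntegrableOn (fun s => (1 - P.a₁) * Real.exp (-P.r₂ * s)) (Ico 0 t) m := fun m _ =>
    (by fun_prop : Continuous fun s =>
      (1 - P.a₁) * Real.exp (-P.r₂ * s)).continuousOn.integrableOn_Icc.mono_set Ico_subset_Icc_self
  have hlin : ∀ (c : ℝ) (m : Measure ℝ), IsLocallyFiniteMeasure m →
      ∫ s in Ico 0 t, (1 - P.a₁ + (1 - q s) * c) * Real.exp (-P.r₂ * s) ∂m =
      (∫ s in Ico 0 t, (1 - P.a₁) * Real.exp (-P.r₂ * s) ∂m)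
        + c * ∫ s in Ico 0 t, (1 - q s) * Real.exp (-P.r₂ * s) ∂m := fun c m hm => by
    rw [← integral_const_mul, ← integral_add (he m hm) ((hi m hm).const_mul c)]
    congr 1; ext s; ring
  have h1 : ∫ s in Ico 0 t, (1 - P.a₁ - (1 - q s) * P.k₂ * P.D) * Real.exp (-P.r₂ * s)
        * (P.γ₁ * Real.exp (-P.γ₁ * s)) =
      (∫ s in Ico 0 t, (1 - P.a₁) * Real.exp (-P.r₂ * s) * (P.γ₁ * Real.exp (-P.γ₁ * s)))
        - P.k₂ * P.D * ∫ s in Ico 0 t, (1 - q s) * Real.exp (-P.r₂ * s)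
          ∂(arrivalDistribution P.γ₁ P.γ₁_nonneg).measure := by
    have := hlin (-(P.k₂ * P.D)) (arrivalDistribution P.γ₁ P.γ₁_nonneg).measure inferInstance
    rw [neg_mul, ← sub_eq_add_neg] at this
    rw [← setIntegral_arrivalDistribution P.γ₁_nonneg,
      ← setIntegral_arrivalDistribution P.γ₁_nonneg, ← this]
    congr 1; ext s; ring
  have h2 : ∫ s in Ico 0 t, (1 - P.a₁ + (1 - q s) * (1 - P.w₁ - P.k₂) * P.D)
        * Real.exp (-P.r₂ * s) ∂S₁.G.measure =
      (∫ s in Ico 0 t, (1 - P.a₁) * Real.exp (-P.r₂ * s) ∂S₁.G.measure)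
        + (1 - P.w₁ - P.k₂) * P.D
          * ∫ s in Ico 0 t, (1 - q s) * Real.exp (-P.r₂ * s) ∂S₁.G.measure := by
    rw [← hlin _ _ inferInstance]
    congr 1; ext s; ring
  rw [concedeUtility₂, concedeUtility₂, h1, h2]
  simp only [sub_self, zero_mul, sub_zero, add_zero]
  ring

end UltimatumBargaining

/-! ### Pure deviations and best responses. -/

namespace StieltjesFunction

variable {F : StieltjesFunction ℝ}

lemma tendsto_measureReal_univ (hF : ∀ t < 0, F t = 0) (h1 : ∀ t, F t ≤ 1) :
    Tendsto F atTop (𝓝 (F.measure.real univ)) := by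
  have hbot : Tendsto F atBot (𝓝 0) := by
    refine tendsto_const_nhds.congr' ?_
    filter_upwards [eventually_lt_atBot 0] with t ht using (hF t ht).symm
  have htop := tendsto_atTop_ciSup F.mono ⟨1, by rintro _ ⟨t, rfl⟩; exact h1 t⟩
  have h0 : 0 ≤ ⨆ t, F t := ge_of_tendsto' htop (nonneg_of_neg hF)
  rwa [measureReal_def, F.measure_univ hbot htop, sub_zero, ENNReal.toReal_ofReal h0]

end StieltjesFunction

/-- If a maximal payoff `u` is attained by mixing between two kinds of actions with total mass at
most one, then almost all actions attain it and no mass is lost. -/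
lemma ae_eq_of_integral_add_eq {α : Type*} [MeasurableSpace α] {μ ν : Measure α}
    [IsFiniteMeasure μ] [IsFiniteMeasure ν] {f g : α → ℝ} {u : ℝ} (hu : 0 < u)
    (hf : ∀ᵐ t ∂μ, f t ≤ u) (hg : ∀ᵐ t ∂ν, g t ≤ u)
    (hmass : μ.real univ + ν.real univ ≤ 1) (h : ∫ t, f t ∂μ + ∫ t, g t ∂ν = u) :
    (∀ᵐ t ∂μ, f t = u) ∧ (∀ᵐ t ∂ν, g t = u) ∧ μ.real univ + ν.real univ = 1 := by
  have key : ∀ (κ : Measure α) [IsFiniteMeasure κ] (k : α → ℝ), (∀ᵐ t ∂κ, k t ≤ u) →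
      ∫ t, k t ∂κ ≤ u * κ.real univ := fun κ _ k hk => by
    -- Integrability is not assumed: a non-integrable utility has integral `0`, which is harmless
    -- because `u > 0`.
    by_cases hi : Integrable k κ
    · simpa [mul_comm] using integral_mono_ae hi (integrable_const u) hk
    · rw [integral_undef hi]
      positivity
  have keq : ∀ (κ : Measure α) [IsFiniteMeasure κ] (k : α → ℝ), (∀ᵐ t ∂κ, k t ≤ u) →
      ∫ t, k t ∂κ = u * κ.real univ → ∀ᵐ t ∂κ, k t = u := fun κ _ k hk he => by
    by_cases hi : Integrable k κ
    · have h1 : ∫ t, (u - k t) ∂κ = 0 := by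
        rw [integral_sub (integrable_const u) hi, he]
        simp [mul_comm]
      rw [integral_eq_zero_iff_of_nonneg_ae (f := fun t => u - k t) (by
        filter_upwards [hk] with t ht using sub_nonneg.2 ht) ((integrable_const u).sub hi)] at h1
      filter_upwards [h1] with t ht
      exact (sub_eq_zero.1 ht).symm
    · rw [integral_undef hi] at he
      have h0 : κ.real univ = 0 := by
        rcases mul_eq_zero.1 he.symm with h | h
        · exact absurd h hu.ne'
        · exact h
      rw [measureReal_eq_zero_iff, Measure.measure_univ_eq_zero] at h0
      simp [h0]
  have h1 := key μ f hf
  have h2 := key ν g hg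
  have h3 : u * (μ.real univ + ν.real univ) ≤ u * 1 := mul_le_mul_of_nonneg_left hmass hu.le
  have h4 : u * (μ.real univ + ν.real univ) = u * 1 := by linarith
  exact ⟨keq μ f hf (by linarith), keq ν g hg (by linarith), mul_left_cancel₀ hu.ne' h4⟩

namespace Strategy₁

variable (S : Strategy₁)

lemma F_le_one (t : ℝ) : S.F t ≤ 1 := by
  linarith [S.add_le_one t, StieltjesFunction.nonneg_of_neg S.G_neg t]

lemma G_le_one (t : ℝ) : S.G t ≤ 1 := by
  linarith [S.add_le_one t, StieltjesFunction.nonneg_of_neg S.F_neg t]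

instance : IsFiniteMeasure S.F.measure :=
  StieltjesFunction.isFiniteMeasure_of_le_one S.F_neg S.F_le_one

instance : IsFiniteMeasure S.G.measure :=
  StieltjesFunction.isFiniteMeasure_of_le_one S.G_neg S.G_le_one

lemma mass_le_one : S.F.measure.real univ + S.G.measure.real univ ≤ 1 :=
  le_of_tendsto' ((StieltjesFunction.tendsto_measureReal_univ S.F_neg S.F_le_one).add
    (StieltjesFunction.tendsto_measureReal_univ S.G_neg S.G_le_one)) S.add_le_one

/-- Concede at time `t` for sure. -/
def concedeAt {t : ℝ} (ht : 0 ≤ t) : Strategy₁ where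
  F := StieltjesFunction.unitStep t
  G := 0
  F_neg s hs := if_neg (not_le.2 (hs.trans_le ht))
  G_neg _ _ := rfl
  add_le_one s := by
    rw [StieltjesFunction.unitStep_apply, StieltjesFunction.zero_apply]
    split_ifs <;> norm_num

/-- Challenge at time `t` for sure. -/
def challengeAt {t : ℝ} (ht : 0 ≤ t) : Strategy₁ where
  F := 0
  G := StieltjesFunction.unitStep t
  F_neg _ _ := rfl
  G_neg s hs := if_neg (not_le.2 (hs.trans_le ht))
  add_le_one s := by
    rw [StieltjesFunction.unitStep_apply, StieltjesFunction.zero_apply]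
    split_ifs <;> norm_num

end Strategy₁

namespace Strategy₂

variable (S : Strategy₂)

instance : IsFiniteMeasure S.F.measure :=
  StieltjesFunction.isFiniteMeasure_of_le_one S.F_neg S.F_le_one

lemma mass_le_one : S.F.measure.real univ ≤ 1 :=
  le_of_tendsto' (StieltjesFunction.tendsto_measureReal_univ S.F_neg S.F_le_one) S.F_le_one

/-- Concede at time `t` for sure and yield to challenges according to `q`. -/
def concedeAt {t : ℝ} (ht : 0 ≤ t) (q : ℝ → ℝ) (hqm : Measurable q)
    (hq : ∀ t, q t ∈ Icc (0 : ℝ) 1) : Strategy₂ where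
  F := StieltjesFunction.unitStep t
  q := q
  F_neg s hs := if_neg (not_le.2 (hs.trans_le ht))
  F_le_one s := by
    rw [StieltjesFunction.unitStep_apply]
    split_ifs <;> norm_num
  q_measurable := hqm
  q_mem := hq

end Strategy₂

namespace UltimatumBargaining

variable {P : UltimatumBargaining} {z₁ z₂ t : ℝ} {S₁ : Strategy₁} {S₂ : Strategy₂}

lemma setIntegral_unitStep (ht : 0 ≤ t) (f : ℝ → ℝ) :
    ∫ s in Ici 0, f s ∂(StieltjesFunction.unitStep t).measure = f t := by
  classical
  rw [StieltjesFunction.unitStep_measure, setIntegral_dirac, if_pos (mem_Ici.2 ht)]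

lemma payoff₁_concedeAt (ht : 0 ≤ t) :
    P.payoff₁ z₂ (Strategy₁.concedeAt ht) S₂ = P.concedeUtility₁ z₂ t S₂ := by
  rw [payoff₁, Strategy₁.concedeAt]
  simp [setIntegral_unitStep ht, StieltjesFunction.measure_zero]

lemma payoff₁_challengeAt (ht : 0 ≤ t) :
    P.payoff₁ z₂ (Strategy₁.challengeAt ht) S₂ = P.challengeUtility₁ z₂ t S₂ := by
  rw [payoff₁, Strategy₁.challengeAt]
  simp [setIntegral_unitStep ht, StieltjesFunction.measure_zero]

lemma payoff₂_concedeAt (ht : 0 ≤ t) (q : ℝ → ℝ) (hqm : Measurable q)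
    (hq : ∀ t, q t ∈ Icc (0 : ℝ) 1) :
    P.payoff₂ z₁ S₁ (Strategy₂.concedeAt ht q hqm hq) = P.concedeUtility₂ z₁ t q S₁ :=
  setIntegral_unitStep ht _

/-- A bound up to the jumps of a Stieltjes function holds exactly for a right-continuous function,
since the jumps just after `t` vanish in the limit. -/
lemma le_of_le_add_jump {F : StieltjesFunction ℝ} {f : ℝ → ℝ} {C m : ℝ}
    (hf : ContinuousWithinAt f (Ici t) t)
    (h : ∀ s, t ≤ s → f s ≤ m + C * (F s - Function.leftLim F s)) (hC : 0 ≤ C) : f t ≤ m := by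
  have h1 : Tendsto f (𝓝[>] t) (𝓝 (f t)) :=
    hf.tendsto.mono_left (nhdsWithin_mono _ Ioi_subset_Ici_self)
  have h2 : Tendsto (fun s => m + C * (F s - F t)) (𝓝[>] t) (𝓝 (m + C * (F t - F t))) :=
    ((((F.right_continuous t).tendsto.mono_left
      (nhdsWithin_mono _ Ioi_subset_Ici_self)).sub_const _).const_mul C).const_add m
  rw [sub_self, mul_zero, add_zero] at h2
  refine le_of_tendsto_of_tendsto h1 h2 ?_
  filter_upwards [self_mem_nhdsWithin] with s hs
  have h3 : F t ≤ Function.leftLim F s := F.mono.le_leftLim hs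
  have := mul_le_mul_of_nonneg_left (sub_le_sub_left h3 (F s)) hC
  linarith [h s (mem_Ioi.1 hs).le]

section player₁

variable (hE : P.IsEquilibrium z₁ z₂ S₁ S₂) (hz₂ : 0 < z₂ ∧ z₂ < 1)
include hE hz₂

/-- Conceding at times decreasing to `t` collects the atom of player 2 at `t` without a tie, so the
tie penalty disappears in the limit. -/
lemma gain₁_le (ht : 0 ≤ t) :
    1 - P.a₂ + P.D * P.gain₁ z₂ S₂ t ≤ P.payoff₁ z₂ S₁ S₂ := by
  have hz : 0 ≤ 1 - z₂ := sub_nonneg.2 hz₂.2.le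
  refine le_of_le_add_jump (F := S₂.F) (C := P.D / 2 * (1 - z₂)) (t := t)
    (f := fun t => 1 - P.a₂ + P.D * P.gain₁ z₂ S₂ t) ?_ (fun s hs => ?_)
    (mul_nonneg (by linarith [P.D_pos]) hz)
  · refine continuousWithinAt_const.add (continuousWithinAt_const.mul ?_)
    refine waitingGain_continuousWithinAt (S₂.F.mono.const_mul hz) (fun x y hxy => ?_)
      (fun t => continuousWithinAt_const.mul (S₂.F.right_continuous t)) t
    have := mul_le_mul_of_nonneg_left (S₂.F.mono hxy) hz
    linarith
  · have h0 : 0 ≤ s := ht.trans hs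
    have h1 := hE.1 (Strategy₁.concedeAt h0)
    rw [payoff₁_concedeAt, concedeUtility₁_eq hz₂.2.le h0] at h1
    have h2 : Real.exp (-P.r₁ * s) ≤ 1 := Real.exp_le_one_iff.2 (by nlinarith [P.r₁_pos])
    have h3 : 0 ≤ P.D / 2 * (1 - z₂) * (S₂.F s - Function.leftLim S₂.F s) :=
      mul_nonneg (mul_nonneg (by linarith [P.D_pos]) hz) (sub_nonneg.2 (S₂.F.leftLim_le_self s))
    nlinarith [mul_le_mul_of_nonneg_left h2 h3]

lemma payoff₁_pos : 0 < P.payoff₁ z₂ S₁ S₂ := by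
  have h := gain₁_le hE hz₂ le_rfl
  rw [gain₁, waitingGain_zero] at h
  have h1 := mul_nonneg P.D_pos.le (mul_nonneg (sub_nonneg.2 hz₂.2.le)
    (StieltjesFunction.nonneg_of_neg S₂.F_neg 0))
  linarith [P.a₂_lt_one]

lemma best_response₁ :
    (∀ᵐ t ∂S₁.F.measure, 0 ≤ t ∧ P.concedeUtility₁ z₂ t S₂ = P.payoff₁ z₂ S₁ S₂) ∧
    (∀ᵐ t ∂S₁.G.measure, 0 ≤ t ∧ P.challengeUtility₁ z₂ t S₂ = P.payoff₁ z₂ S₁ S₂) ∧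
    S₁.F.measure.real univ + S₁.G.measure.real univ = 1 := by
  have hF := StieltjesFunction.measure_restrict_Ici_zero S₁.F_neg
  have hG := StieltjesFunction.measure_restrict_Ici_zero S₁.G_neg
  have hFp : ∀ᵐ t ∂S₁.F.measure, 0 ≤ t := by
    rw [← hF]; exact ae_restrict_mem measurableSet_Ici
  have hGp : ∀ᵐ t ∂S₁.G.measure, 0 ≤ t := by
    rw [← hG]; exact ae_restrict_mem measurableSet_Ici
  have h := ae_eq_of_integral_add_eq (μ := S₁.F.measure) (ν := S₁.G.measure)
    (f := fun t => P.concedeUtility₁ z₂ t S₂) (g := fun t => P.challengeUtility₁ z₂ t S₂)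
    (payoff₁_pos hE hz₂)
    (by filter_upwards [hFp] with t ht using
      payoff₁_concedeAt (P := P) (z₂ := z₂) (S₂ := S₂) ht ▸ hE.1 (Strategy₁.concedeAt ht))
    (by filter_upwards [hGp] with t ht using
      payoff₁_challengeAt (P := P) (z₂ := z₂) (S₂ := S₂) ht ▸ hE.1 (Strategy₁.challengeAt ht))
    S₁.mass_le_one (by rw [payoff₁, hF, hG])
  exact ⟨hFp.and h.1, hGp.and h.2.1, h.2.2⟩

/-- At an atom of player 2, waiting an instant avoids the tie penalty, so no optimal concession time
is such an atom. -/
lemma ae_gain₁_eq : ∀ᵐ t ∂S₁.F.measure,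
    1 - P.a₂ + P.D * P.gain₁ z₂ S₂ t = P.payoff₁ z₂ S₁ S₂ ∧ Function.leftLim S₂.F t = S₂.F t := by
  filter_upwards [(best_response₁ hE hz₂).1] with t ht
  have h1 := gain₁_le hE hz₂ ht.1
  have h2 := ht.2
  rw [concedeUtility₁_eq hz₂.2.le ht.1] at h2
  have h3 : 0 < P.D / 2 * (1 - z₂) * Real.exp (-P.r₁ * t) :=
    mul_pos (mul_pos (by linarith [P.D_pos]) (sub_pos.2 hz₂.2)) (Real.exp_pos _)
  have h4 := sub_nonneg.2 (S₂.F.leftLim_le_self t)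
  have h5 : P.D / 2 * (1 - z₂) * Real.exp (-P.r₁ * t) * (S₂.F t - Function.leftLim S₂.F t) = 0 :=
    le_antisymm (by linarith) (mul_nonneg h3.le h4)
  exact ⟨by linarith, by linarith [(mul_eq_zero.1 h5).resolve_left h3.ne']⟩

/-- Player 1 challenges only when player 2 may still concede and may yield to the challenge. -/
lemma ae_challenge : ∀ᵐ t ∂S₁.G.measure, 0 < S₂.q t ∧ S₂.F t < 1 := by
  filter_upwards [(best_response₁ hE hz₂).2.1] with t ht
  have h1 := gain₁_le hE hz₂ ht.1
  have h2 := ht.2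
  rw [challengeUtility₁_eq hz₂.2.le ht.1] at h2
  have h3 : 0 < P.D * Real.exp (-P.r₁ * t) := mul_pos P.D_pos (Real.exp_pos _)
  -- The net cost of an optimal challenge is nonpositive, since conceding just after `t` is
  -- available. With `q = 0` the cost is at least `c₁ z₂` because `w₁ < c₁`, and with `F = 1` it
  -- equals `c₁ z₂`.
  have h4 : P.c₁ * (1 - (1 - z₂) * S₂.F t)
        - (1 - z₂) * (1 - S₂.F t) * ((1 - S₂.q t) * P.w₁ + S₂.q t) ≤ 0 := by
    by_contra! h
    linarith [mul_pos h3 h]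
  have hc : 0 < P.c₁ := P.w₁_nonneg.trans_lt P.w₁_lt_c₁
  have hF := S₂.F_le_one t
  have hz : 0 < 1 - z₂ := sub_pos.2 hz₂.2
  have hs : 0 ≤ (1 - z₂) * (1 - S₂.F t) := mul_nonneg hz.le (sub_nonneg.2 hF)
  constructor
  · by_contra! hq
    have hq0 : S₂.q t = 0 := le_antisymm hq (S₂.q_mem t).1
    rw [hq0] at h4
    nlinarith [P.w₁_lt_c₁, mul_nonneg hs (sub_nonneg.2 P.w₁_lt_c₁.le), mul_pos hc hz₂.1]
  · refine lt_of_le_of_ne hF fun h => ?_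
    rw [h] at h4
    nlinarith [mul_pos hc hz₂.1]

end player₁

end UltimatumBargaining

/-! ### Domination of unjustified challenges by justified ones. -/

lemma MeasureTheory.Measure.le_of_countable_cover {α ι : Type*} [MeasurableSpace α] [Denumerable ι]
    {μ ν : Measure α} {C : ι → Set α} (hC : ∀ i, MeasurableSet (C i))
    (h : ∀ i s, MeasurableSet s → s ⊆ C i → ν s ≤ μ s) (hcov : ∀ᵐ x ∂ν, ∃ i, x ∈ C i) :
    ν ≤ μ := by
  set B : ℕ → Set α := fun n => C (Denumerable.ofNat ι n) with hB
  have hBm : ∀ n, MeasurableSet (disjointed B n) := fun n => MeasurableSet.disjointed (fun _ => hC _) n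
  refine Measure.le_intro fun s hs _ => ?_
  have hae : s =ᵐ[ν] ⋃ n, s ∩ disjointed B n := by
    rw [← inter_iUnion, iUnion_disjointed]
    filter_upwards [hcov] with x hx
    obtain ⟨i, hi⟩ := hx
    have : x ∈ ⋃ n, B n := mem_iUnion.2 ⟨Encodable.encode i, by simpa [hB] using hi⟩
    exact propext ⟨fun h => ⟨h, this⟩, fun h => h.1⟩
  have hd : Pairwise (Function.onFun Disjoint fun n => s ∩ disjointed B n) := fun i j hij =>
    (disjoint_disjointed B hij).mono inter_subset_right inter_subset_right
  rw [measure_congr hae, measure_iUnion hd fun n => hs.inter (hBm n)]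
  calc ∑' n, ν (s ∩ disjointed B n) ≤ ∑' n, μ (s ∩ disjointed B n) :=
        ENNReal.tsum_le_tsum fun n => h (Denumerable.ofNat ι n) _ (hs.inter (hBm n))
          (inter_subset_right.trans (disjointed_subset B n))
    _ = μ (⋃ n, s ∩ disjointed B n) := (measure_iUnion hd fun n => hs.inter (hBm n)).symm
    _ ≤ μ s := measure_mono (iUnion_subset fun n => inter_subset_left)

namespace UltimatumBargaining

variable {P : UltimatumBargaining} {z₁ z₂ t : ℝ} {S₁ : Strategy₁} {S₂ : Strategy₂}
  (hE : P.IsEquilibrium z₁ z₂ S₁ S₂) (hz₁ : 0 < z₁ ∧ z₁ < 1) (hz₂ : 0 < z₂ ∧ z₂ < 1)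

include hE in
lemma concedeUtility₂_le (ht : 0 ≤ t) {q : ℝ → ℝ} (hqm : Measurable q)
    (hq : ∀ t, q t ∈ Icc (0 : ℝ) 1) : P.concedeUtility₂ z₁ t q S₁ ≤ P.payoff₂ z₁ S₁ S₂ :=
  payoff₂_concedeAt (P := P) (z₁ := z₁) (S₁ := S₁) ht q hqm hq ▸ hE.2 _

include hE hz₁ in
lemma gain₂_le (ht : 0 ≤ t) :
    1 - P.a₁ + P.D * P.gain₂ z₁ S₁ t ≤ P.payoff₂ z₁ S₁ S₂ := by
  have hz : 0 ≤ 1 - z₁ := sub_nonneg.2 hz₁.2.le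
  refine le_of_le_add_jump (F := S₁.F) (C := P.D / 2 * (1 - z₁)) (t := t)
    (f := fun t => 1 - P.a₁ + P.D * P.gain₂ z₁ S₁ t) ?_ (fun s hs => ?_)
    (mul_nonneg (by linarith [P.D_pos]) hz)
  · exact continuousWithinAt_const.add (continuousWithinAt_const.mul
      (waitingGain_continuousWithinAt (S₁.F.mono.const_mul hz) (survival₁_anti hz₁.1.le hz₁.2.le)
        (fun t => continuousWithinAt_const.mul (S₁.F.right_continuous t)) t))
  · have h0 : 0 ≤ s := ht.trans hs
    have h1 := concedeUtility₂_le hE h0 (q := fun _ => 1) measurable_const (by simp)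
    rw [concedeUtility₂_one_eq hz₁.1.le hz₁.2.le h0] at h1
    have h2 : Real.exp (-P.r₂ * s) ≤ 1 := Real.exp_le_one_iff.2 (by nlinarith [P.r₂_pos])
    have h3 : 0 ≤ P.D / 2 * (1 - z₁) * (S₁.F s - Function.leftLim S₁.F s) :=
      mul_nonneg (mul_nonneg (by linarith [P.D_pos]) hz) (sub_nonneg.2 (S₁.F.leftLim_le_self s))
    nlinarith [mul_le_mul_of_nonneg_left h2 h3]

include hE hz₁ in
lemma payoff₂_pos : 0 < P.payoff₂ z₁ S₁ S₂ := by
  have h := gain₂_le hE hz₁ le_rfl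
  rw [gain₂, waitingGain_zero] at h
  have h1 := mul_nonneg P.D_pos.le (mul_nonneg (sub_nonneg.2 hz₁.2.le)
    (StieltjesFunction.nonneg_of_neg S₁.F_neg 0))
  linarith [P.a₁_lt_one]

include hE hz₁ in
lemma best_response₂ :
    (∀ᵐ t ∂S₂.F.measure, 0 ≤ t ∧ P.concedeUtility₂ z₁ t S₂.q S₁ = P.payoff₂ z₁ S₁ S₂) ∧
    S₂.F.measure.real univ = 1 := by
  have hF := StieltjesFunction.measure_restrict_Ici_zero S₂.F_neg
  have hFp : ∀ᵐ t ∂S₂.F.measure, 0 ≤ t := by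
    rw [← hF]; exact ae_restrict_mem measurableSet_Ici
  have h := ae_eq_of_integral_add_eq (μ := S₂.F.measure) (ν := 0)
    (f := fun t => P.concedeUtility₂ z₁ t S₂.q S₁) (g := fun _ => 0) (payoff₂_pos hE hz₁)
    (by filter_upwards [hFp] with t ht using
      concedeUtility₂_le hE ht S₂.q_measurable S₂.q_mem)
    (by simp) (by simpa using S₂.mass_le_one) (by simp [payoff₂, hF])
  exact ⟨hFp.and h.1, by simpa using h.2.2⟩

include hE hz₁ in
lemma measure_Ioi₂_ne_zero (ht : 0 ≤ t) (hF : S₂.F t < 1) : S₂.F.measure (Ioi t) ≠ 0 := fun h => by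
  have h1 := StieltjesFunction.measureReal_Ioi_eq S₂.F_neg ht
  rw [measureReal_def, h, (best_response₂ hE hz₁).2] at h1
  simp at h1
  linarith

/-- Unjustified challenges seen by player 2 are, weighted by the gains and losses from seeing,
not more frequent than justified ones before any optimal concession time. -/
lemma challenge_measure_le_of_optimal (hE : P.IsEquilibrium z₁ z₂ S₁ S₂) (hz₁ : 0 < z₁ ∧ z₁ < 1)
    (hz₂ : 0 < z₂ ∧ z₂ < 1) (ht : 0 ≤ t)
    (hopt : P.concedeUtility₂ z₁ t S₂.q S₁ = P.payoff₂ z₁ S₁ S₂) :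
    (ENNReal.ofReal ((1 - P.w₁ - P.k₂) * (1 - z₁)) • S₁.G.measure).restrict (Ico 0 t) ≤
      (ENNReal.ofReal (P.k₂ * z₁) •
        (arrivalDistribution P.γ₁ P.γ₁_nonneg).measure).restrict (Ico 0 t) := by
  have hα : 0 ≤ (1 - P.w₁ - P.k₂) * (1 - z₁) :=
    mul_nonneg (by linarith [P.k₂_lt]) (sub_nonneg.2 hz₁.2.le)
  have hβ : 0 ≤ P.k₂ * z₁ := mul_nonneg P.k₂_pos.le hz₁.1.le
  have hi : ∀ (g : ℝ → ℝ), Measurable g → (∀ s, g s ∈ Icc (0 : ℝ) 1) → ∀ m : Measure ℝ,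
      IsLocallyFiniteMeasure m →
      IntegrableOn (fun s => g s * Real.exp (-P.r₂ * s)) (Ico 0 t) m := fun g hgm hg m _ =>
    integrableOn_mul_exp m hgm
      (fun s => abs_le.2 ⟨by linarith [(hg s).1], (hg s).2⟩) _ _
  have hq0 := fun s => (S₂.q_mem s).1
  have hq1 := fun s => (S₂.q_mem s).2
  have hqi := hi S₂.q S₂.q_measurable S₂.q_mem
  rw [Measure.restrict_smul, Measure.restrict_smul]
  refine Measure.le_of_forall_setIntegral_le (f := fun s => S₂.q s * Real.exp (-P.r₂ * s))
    (S₂.q_measurable.mul (by fun_prop)) (fun s => mul_nonneg (hq0 s) (Real.exp_pos _).le)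
    ((hqi _ inferInstance).smul_measure ENNReal.ofReal_ne_top)
    ((hqi _ inferInstance).smul_measure ENNReal.ofReal_ne_top) (fun A hA => ?_) ?_
  -- The deviation keeps the concession time `t` but sees every challenge made in `A`; the change in
  -- `1 - q` is `q` on `A`.
  · have hq'm : Measurable (Aᶜ.indicator S₂.q) := S₂.q_measurable.indicator hA.compl
    have hq' : ∀ s, Aᶜ.indicator S₂.q s ∈ Icc (0 : ℝ) 1 := fun s => by
      by_cases h : s ∈ Aᶜ
      · rw [indicator_of_mem h]; exact S₂.q_mem s
      · rw [indicator_of_notMem h]; simp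
    have h1 := concedeUtility₂_le hE ht hq'm hq'
    rw [← hopt, concedeUtility₂_eq_add hq'm hq', concedeUtility₂_eq_add S₂.q_measurable S₂.q_mem]
      at h1
    have hsplit : ∀ m : Measure ℝ, IsLocallyFiniteMeasure m →
        ∫ s in Ico 0 t, (1 - Aᶜ.indicator S₂.q s) * Real.exp (-P.r₂ * s) ∂m =
        (∫ s in Ico 0 t, (1 - S₂.q s) * Real.exp (-P.r₂ * s) ∂m)
          + ∫ s in A, S₂.q s * Real.exp (-P.r₂ * s) ∂(m.restrict (Ico 0 t)) := fun m hm => by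
      rw [← integral_indicator hA, ← integral_add]
      · congr 1; ext s
        by_cases h : s ∈ A
        · rw [indicator_of_notMem (notMem_compl_iff.2 h), indicator_of_mem h]; ring
        · rw [indicator_of_mem (mem_compl h), indicator_of_notMem h]; ring
      · exact hi (fun s => 1 - S₂.q s) (measurable_const.sub S₂.q_measurable)
          (fun s => ⟨sub_nonneg.2 (hq1 s), by linarith [hq0 s]⟩) m hm
      · exact (hqi m hm).integrable.indicator hA
    rw [hsplit _ inferInstance, hsplit _ inferInstance] at h1
    rw [Measure.restrict_smul, Measure.restrict_smul, integral_smul_measure, integral_smul_measure,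
      ENNReal.toReal_ofReal hα, ENNReal.toReal_ofReal hβ, smul_eq_mul, smul_eq_mul]
    have h2 := P.D_pos
    refine le_of_mul_le_mul_left ?_ h2
    linarith
  -- The weight can be cancelled because player 1 challenges only where `q > 0`.
  · have h1 : ∀ᵐ s ∂S₁.G.measure, 0 < S₂.q s * Real.exp (-P.r₂ * s) := by
      filter_upwards [ae_challenge hE hz₂] with s hs using mul_pos hs.1 (Real.exp_pos _)
    exact (Measure.ae_smul_measure (ae_restrict_of_ae h1) _)

/-- Unjustified challenges are, weighted by player 2's gains and losses from seeing a challenge, not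
more frequent than justified ones. -/
lemma challenge_measure_le (hE : P.IsEquilibrium z₁ z₂ S₁ S₂) (hz₁ : 0 < z₁ ∧ z₁ < 1)
    (hz₂ : 0 < z₂ ∧ z₂ < 1) :
    ENNReal.ofReal ((1 - P.w₁ - P.k₂) * (1 - z₁)) • S₁.G.measure ≤
      ENNReal.ofReal (P.k₂ * z₁) • (arrivalDistribution P.γ₁ P.γ₁_nonneg).measure := by
  classical
  -- If `F₂ y < 1`, player 2 has an optimal concession time beyond `y`, so the comparison holds on
  -- `[0, y]`. Almost every challenge time `x` has `F₂ x < 1`, and right-continuity gives such a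
  -- rational `y > x`.
  refine Measure.le_of_countable_cover (ι := ℚ)
    (C := fun y => if S₂.F y < 1 then Icc (0 : ℝ) y else ∅) (fun y => ?_) (fun y s hs hsub => ?_) ?_
  · split_ifs
    exacts [measurableSet_Icc, MeasurableSet.empty]
  · split_ifs at hsub with hy
    · rcases lt_or_ge (y : ℝ) 0 with h0 | h0
      · rw [Icc_eq_empty (not_le.2 h0), subset_empty_iff] at hsub
        simp [hsub]
      obtain ⟨t, ht, ht0, hopt⟩ := StieltjesFunction.exists_mem_of_ae (best_response₂ hE hz₁).1
        (measure_Ioi₂_ne_zero hE hz₁ h0 hy)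
      have h := challenge_measure_le_of_optimal hE hz₁ hz₂ ht0 hopt s
      have hst : s ∩ Ico 0 t = s := inter_eq_left.2 fun x hx =>
        ⟨(hsub hx).1, (hsub hx).2.trans_lt ht⟩
      rwa [Measure.restrict_apply hs, Measure.restrict_apply hs, hst] at h
    · rw [subset_empty_iff] at hsub
      simp [hsub]
  · refine Measure.ae_smul_measure ?_ _
    filter_upwards [ae_challenge hE hz₂, (best_response₁ hE hz₂).2.1] with x hx hx'
    have h1 : ∀ᶠ y in 𝓝[>] x, S₂.F y < 1 :=
      ((S₂.F.right_continuous x).tendsto.mono_left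
        (nhdsWithin_mono _ Ioi_subset_Ici_self)).eventually_lt_const hx.2
    obtain ⟨u, hu, hu'⟩ := mem_nhdsGT_iff_exists_Ioo_subset.1 h1
    obtain ⟨y, hy, hy'⟩ := exists_rat_btwn (mem_Ioi.1 hu)
    refine ⟨y, ?_⟩
    have hFy : S₂.F y < 1 := hu' ⟨hy, hy'⟩
    rw [if_pos hFy]
    exact ⟨hx'.1, hy.le⟩

section

include hE hz₁ hz₂

lemma G_sub_le {s : ℝ} (hst : s ≤ t) : (1 - P.w₁ - P.k₂) * (1 - z₁) * (S₁.G t - S₁.G s) ≤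
    P.k₂ * z₁ * (arrivalDistribution P.γ₁ P.γ₁_nonneg t
      - arrivalDistribution P.γ₁ P.γ₁_nonneg s) := by
  have hα : 0 ≤ (1 - P.w₁ - P.k₂) * (1 - z₁) :=
    mul_nonneg (by linarith [P.k₂_lt]) (sub_nonneg.2 hz₁.2.le)
  have hβ : 0 ≤ P.k₂ * z₁ := mul_nonneg P.k₂_pos.le hz₁.1.le
  have h := challenge_measure_le hE hz₁ hz₂ (Ioc s t)
  rw [Measure.smul_apply, Measure.smul_apply, StieltjesFunction.measure_Ioc,
    StieltjesFunction.measure_Ioc, smul_eq_mul, smul_eq_mul, ← ENNReal.ofReal_mul hα,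
    ← ENNReal.ofReal_mul hβ, ENNReal.ofReal_le_ofReal_iff (mul_nonneg hβ
      (sub_nonneg.2 (StieltjesFunction.mono _ hst)))] at h
  exact h

/-- Atoms are excluded by domination by the atomless arrival distribution. -/
lemma G_continuous : Continuous S₁.G := by
  rw [continuous_iff_continuousAt]
  intro t
  refine continuousAt_iff_continuous_left_right.2 ⟨?_, S₁.G.right_continuous t⟩
  have hα : 0 < (1 - P.w₁ - P.k₂) * (1 - z₁) :=
    mul_pos (by linarith [P.k₂_lt]) (sub_pos.2 hz₁.2)
  set H := arrivalDistribution P.γ₁ P.γ₁_nonneg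
  set c := P.k₂ * z₁ / ((1 - P.w₁ - P.k₂) * (1 - z₁)) with hc
  have h1 : Tendsto (fun s => S₁.G t - c * (H t - H s)) (𝓝[≤] t)
      (𝓝 (S₁.G t - c * (H t - H t))) :=
    (((((arrivalDistribution_continuous P.γ₁_nonneg).tendsto t).mono_left
      nhdsWithin_le_nhds).const_sub _).const_mul c).const_sub _
  rw [sub_self, mul_zero, sub_zero] at h1
  refine tendsto_of_tendsto_of_tendsto_of_le_of_le' h1 tendsto_const_nhds ?_ ?_
  · filter_upwards [self_mem_nhdsWithin] with s hs
    have h2 := G_sub_le hE hz₁ hz₂ (mem_Iic.1 hs)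
    rw [mul_comm, ← le_div_iff₀ hα] at h2
    have h3 : P.k₂ * z₁ * (H t - H s) / ((1 - P.w₁ - P.k₂) * (1 - z₁)) = c * (H t - H s) := by
      rw [hc]; ring
    linarith
  · filter_upwards [self_mem_nhdsWithin] with s hs using S₁.G.mono hs

/-- Yielding to all challenges is optimal for player 2. -/
lemma concedeUtility₂_le_one : P.concedeUtility₂ z₁ t S₂.q S₁ ≤
    P.concedeUtility₂ z₁ t (fun _ => 1) S₁ := by
  have hα : 0 ≤ (1 - P.w₁ - P.k₂) * (1 - z₁) :=
    mul_nonneg (by linarith [P.k₂_lt]) (sub_nonneg.2 hz₁.2.le)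
  have hβ : 0 ≤ P.k₂ * z₁ := mul_nonneg P.k₂_pos.le hz₁.1.le
  have hi : IntegrableOn (fun s => (1 - S₂.q s) * Real.exp (-P.r₂ * s)) (Ico 0 t)
      (ENNReal.ofReal (P.k₂ * z₁) • (arrivalDistribution P.γ₁ P.γ₁_nonneg).measure) := by
    rw [IntegrableOn, Measure.restrict_smul]
    exact Integrable.smul_measure (integrableOn_mul_exp _ (g := fun s => 1 - S₂.q s)
      (measurable_const.sub S₂.q_measurable)
      (fun s => abs_le.2 ⟨by linarith [(S₂.q_mem s).2], by linarith [(S₂.q_mem s).1]⟩) _ _)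
      ENNReal.ofReal_ne_top
  have h := integral_mono_measure (Measure.restrict_mono le_rfl (challenge_measure_le hE hz₁ hz₂))
    (ae_of_all _ fun s => mul_nonneg (sub_nonneg.2 (S₂.q_mem s).2) (Real.exp_pos _).le) hi
  rw [Measure.restrict_smul, Measure.restrict_smul, integral_smul_measure, integral_smul_measure,
    ENNReal.toReal_ofReal hα, ENNReal.toReal_ofReal hβ, smul_eq_mul, smul_eq_mul] at h
  rw [concedeUtility₂_eq_add S₂.q_measurable S₂.q_mem]
  have := mul_nonneg P.D_pos.le (sub_nonneg.2 h)
  linarith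

/-- The payoff is at most the utility from yielding always, which by `gain₂_le` is at most the
payoff minus the tie penalty; hence equality throughout. -/
lemma ae_gain₂_eq : ∀ᵐ t ∂S₂.F.measure,
    1 - P.a₁ + P.D * P.gain₂ z₁ S₁ t = P.payoff₂ z₁ S₁ S₂ ∧ Function.leftLim S₁.F t = S₁.F t := by
  filter_upwards [(best_response₂ hE hz₁).1] with t ht
  have h1 := gain₂_le hE hz₁ ht.1
  have h2 := concedeUtility₂_le_one (t := t) hE hz₁ hz₂
  rw [ht.2, concedeUtility₂_one_eq hz₁.1.le hz₁.2.le ht.1] at h2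
  have h3 : 0 < P.D / 2 * (1 - z₁) * Real.exp (-P.r₂ * t) :=
    mul_pos (mul_pos (by linarith [P.D_pos]) (sub_pos.2 hz₁.2)) (Real.exp_pos _)
  have h4 := sub_nonneg.2 (S₁.F.leftLim_le_self t)
  have h5 : P.D / 2 * (1 - z₁) * Real.exp (-P.r₂ * t) * (S₁.F t - Function.leftLim S₁.F t) = 0 :=
    le_antisymm (by linarith) (mul_nonneg h3.le h4)
  exact ⟨by linarith, by linarith [(mul_eq_zero.1 h5).resolve_left h3.ne']⟩

end

end UltimatumBargaining

/-! ### Indifference until the end of concessions, and the resulting bounds. -/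

namespace UltimatumBargaining

variable {P : UltimatumBargaining} {z₁ z₂ t : ℝ} {S₁ : Strategy₁} {S₂ : Strategy₂}

variable (P) in
/-- An upper bound on the ratio of the overall rate of challenges to the rate of justified ones. -/
def challengeRatio : ℝ := (1 - P.w₁) / (1 - P.w₁ - P.k₂)

variable (P) in
/-- The normalized equilibrium payoff of player 1. -/
def maxGain₁ (z₂ : ℝ) (S₁ : Strategy₁) (S₂ : Strategy₂) : ℝ :=
  (P.payoff₁ z₂ S₁ S₂ - (1 - P.a₂)) / P.D

variable (P) in
/-- The normalized equilibrium payoff of player 2. -/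
def maxGain₂ (z₁ : ℝ) (S₁ : Strategy₁) (S₂ : Strategy₂) : ℝ :=
  (P.payoff₂ z₁ S₁ S₂ - (1 - P.a₁)) / P.D

lemma survival₁_ge (h1 : z₁ ≤ 1) (t : ℝ) :
    z₁ * (1 - arrivalDistribution P.γ₁ P.γ₁_nonneg t) ≤ P.survival₁ z₁ S₁ t := by
  have := mul_le_mul_of_nonneg_left (S₁.add_le_one t) (sub_nonneg.2 h1)
  rw [survival₁, challenged₁]
  linarith

lemma arrivalDistribution_lt_one {γ : ℝ} (hγ : 0 ≤ γ) (t : ℝ) : arrivalDistribution γ hγ t < 1 := by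
  change 1 - Real.exp (-γ * max t 0) < 1
  linarith [Real.exp_pos (-γ * max t 0)]

lemma survival₁_pos (h0 : 0 < z₁) (h1 : z₁ ≤ 1) (t : ℝ) : 0 < P.survival₁ z₁ S₁ t :=
  (mul_pos h0 (sub_pos.2 (arrivalDistribution_lt_one _ t))).trans_le (survival₁_ge h1 t)

lemma challenged₁_nonneg (h0 : 0 ≤ z₁) (h1 : z₁ ≤ 1) (t : ℝ) : 0 ≤ P.challenged₁ z₁ S₁ t :=
  add_nonneg (mul_nonneg (sub_nonneg.2 h1) (StieltjesFunction.nonneg_of_neg S₁.G_neg t))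
    (mul_nonneg h0 (StieltjesFunction.nonneg_of_neg (arrivalDistribution_of_neg _) t))

lemma survival₁_le_one (h0 : 0 ≤ z₁) (h1 : z₁ ≤ 1) (t : ℝ) : P.survival₁ z₁ S₁ t ≤ 1 := by
  have h2 := challenged₁_nonneg (P := P) (S₁ := S₁) h0 h1 t
  have h3 := mul_nonneg (sub_nonneg.2 h1) (StieltjesFunction.nonneg_of_neg S₁.F_neg t)
  rw [survival₁]
  linarith

lemma survival₂_anti (h1 : z₂ ≤ 1) : Antitone fun t => 1 - (1 - z₂) * S₂.F t - 0 :=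
  fun x y hxy => by
    have := mul_le_mul_of_nonneg_left (S₂.F.mono hxy) (sub_nonneg.2 h1)
    linarith

lemma survival₂_pos (h0 : 0 < z₂) (h1 : z₂ ≤ 1) (t : ℝ) : 0 < 1 - (1 - z₂) * S₂.F t - 0 := by
  have := mul_le_mul_of_nonneg_left (S₂.F_le_one t) (sub_nonneg.2 h1)
  linarith

lemma survival₂_le_one (h1 : z₂ ≤ 1) (t : ℝ) : 1 - (1 - z₂) * S₂.F t - 0 ≤ 1 := by
  have := mul_nonneg (sub_nonneg.2 h1) (StieltjesFunction.nonneg_of_neg S₂.F_neg t)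
  linarith

variable (hE : P.IsEquilibrium z₁ z₂ S₁ S₂) (hz₁ : 0 < z₁ ∧ z₁ < 1) (hz₂ : 0 < z₂ ∧ z₂ < 1)

include hE hz₁ hz₂

/-- Unjustified challenges after time `s` are bounded by the justified ones. -/
lemma G_mass_sub_le (s : ℝ) :
    (1 - P.w₁ - P.k₂) * (1 - z₁) * (S₁.G.measure.real univ - S₁.G s) ≤
      P.k₂ * z₁ * (1 - arrivalDistribution P.γ₁ P.γ₁_nonneg s) := by
  have hβ : 0 ≤ P.k₂ * z₁ := mul_nonneg P.k₂_pos.le hz₁.1.le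
  refine le_of_tendsto (((StieltjesFunction.tendsto_measureReal_univ S₁.G_neg
    S₁.G_le_one).sub_const (S₁.G s)).const_mul _) ?_
  filter_upwards [eventually_ge_atTop s] with t ht
  exact (G_sub_le hE hz₁ hz₂ ht).trans (mul_le_mul_of_nonneg_left
    (sub_le_sub_right (arrivalDistribution_lt_one _ t).le _) hβ)

/-- Per justified challenge there is at most `k₂ / (1 - w₁ - k₂)` of an unjustified one; adding one
gives `challengeRatio`. -/
lemma challenged₁_sub_le {s : ℝ} (hst : s ≤ t) :
    P.challenged₁ z₁ S₁ t - P.challenged₁ z₁ S₁ s ≤ P.challengeRatio * z₁ *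
      (arrivalDistribution P.γ₁ P.γ₁_nonneg t - arrivalDistribution P.γ₁ P.γ₁_nonneg s) := by
  have h := G_sub_le hE hz₁ hz₂ hst
  have hp : 0 < 1 - P.w₁ - P.k₂ := by linarith [P.k₂_lt]
  rw [challengeRatio, div_mul_eq_mul_div, div_mul_eq_mul_div, le_div_iff₀ hp, challenged₁,
    challenged₁]
  linarith

omit hz₁ in
lemma gain₁_le_maxGain₁ (ht : 0 ≤ t) : P.gain₁ z₂ S₂ t ≤ P.maxGain₁ z₂ S₁ S₂ := by
  rw [maxGain₁, le_div_iff₀' P.D_pos]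
  linarith [gain₁_le hE hz₂ ht]

omit hz₂ in
lemma gain₂_le_maxGain₂ (ht : 0 ≤ t) : P.gain₂ z₁ S₁ t ≤ P.maxGain₂ z₁ S₁ S₂ := by
  rw [maxGain₂, le_div_iff₀' P.D_pos]
  linarith [gain₂_le hE hz₁ ht]

omit hz₁ in
lemma ae_gain₁_eq_maxGain₁ : ∀ᵐ t ∂S₁.F.measure, P.gain₁ z₂ S₂ t = P.maxGain₁ z₂ S₁ S₂ := by
  filter_upwards [ae_gain₁_eq hE hz₂] with t ht
  rw [maxGain₁, eq_div_iff P.D_pos.ne', ← ht.1]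
  ring

lemma ae_gain₂_eq_maxGain₂ : ∀ᵐ t ∂S₂.F.measure, P.gain₂ z₁ S₁ t = P.maxGain₂ z₁ S₁ S₂ := by
  filter_upwards [ae_gain₂_eq hE hz₁ hz₂] with t ht
  rw [maxGain₂, eq_div_iff P.D_pos.ne', ← ht.1]
  ring

lemma gain₁_eq_of_mass (ht : 0 ≤ t) (hm : S₁.F.measure (Ioi t) ≠ 0) :
    P.gain₁ z₂ S₂ t = P.maxGain₁ z₂ S₁ S₂ :=
  waitingGain_eq_of_mass_after (A := S₁.F) (B := S₂.F) (r := P.r₁) (r' := P.r₂)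
    (sub_pos.2 hz₁.2) (sub_pos.2 hz₂.2) P.rate₂_pos P.rate₁_pos
    (survival₂_anti hz₂.2.le) (survival₁_anti (P := P) (S₁ := S₁) hz₁.1.le hz₁.2.le)
    (survival₂_pos hz₂.1 hz₂.2.le) (survival₁_pos hz₁.1 hz₁.2.le)
    (fun _ => gain₁_le_maxGain₁ hE hz₂) (fun _ => gain₂_le_maxGain₂ hE hz₁)
    (ae_gain₁_eq_maxGain₁ hE hz₂) (ae_gain₂_eq_maxGain₂ hE hz₁ hz₂)
    (fun _ h1 h2 => h2.ne (StieltjesFunction.of_ae_of_leftLim_lt (ae_gain₁_eq hE hz₂) h1).2)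
    ht hm

lemma gain₂_eq_of_mass (ht : 0 ≤ t) (hm : S₂.F.measure (Ioi t) ≠ 0) :
    P.gain₂ z₁ S₁ t = P.maxGain₂ z₁ S₁ S₂ :=
  waitingGain_eq_of_mass_after (A := S₂.F) (B := S₁.F) (r := P.r₂) (r' := P.r₁)
    (sub_pos.2 hz₂.2) (sub_pos.2 hz₁.2) P.rate₁_pos P.rate₂_pos
    (survival₁_anti (P := P) (S₁ := S₁) hz₁.1.le hz₁.2.le) (survival₂_anti hz₂.2.le)
    (survival₁_pos hz₁.1 hz₁.2.le) (survival₂_pos hz₂.1 hz₂.2.le)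
    (fun _ => gain₂_le_maxGain₂ hE hz₁) (fun _ => gain₁_le_maxGain₁ hE hz₂)
    (ae_gain₂_eq_maxGain₂ hE hz₁ hz₂) (ae_gain₁_eq_maxGain₁ hE hz₂)
    (fun _ h1 h2 => h2.ne
      (StieltjesFunction.of_ae_of_leftLim_lt (ae_gain₂_eq hE hz₁ hz₂) h1).2)
    ht hm

omit hz₁ in
lemma mass₂_of_mass₁ (ht : 0 ≤ t) (hm : S₁.F.measure (Ioi t) ≠ 0) : S₂.F.measure (Ioi t) ≠ 0 :=
  measure_Ioi_ne_zero_of_opponent (r := P.r₁) (sub_pos.2 hz₂.2) P.rate₂_pos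
    (survival₂_anti hz₂.2.le) (survival₂_pos hz₂.1 hz₂.2.le)
    (fun _ => gain₁_le_maxGain₁ hE hz₂) (ae_gain₁_eq_maxGain₁ hE hz₂) ht hm

lemma mass₁_of_mass₂ (ht : 0 ≤ t) (hm : S₂.F.measure (Ioi t) ≠ 0) : S₁.F.measure (Ioi t) ≠ 0 :=
  measure_Ioi_ne_zero_of_opponent (r := P.r₂) (sub_pos.2 hz₁.2) P.rate₁_pos
    (survival₁_anti (P := P) (S₁ := S₁) hz₁.1.le hz₁.2.le) (survival₁_pos hz₁.1 hz₁.2.le)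
    (fun _ => gain₂_le_maxGain₂ hE hz₁) (ae_gain₂_eq_maxGain₂ hE hz₁ hz₂) ht hm

omit hz₁ in
lemma not_both_concede_at_zero (h : 0 < S₁.F 0) : S₂.F 0 = 0 := by
  have h1 := StieltjesFunction.of_ae_of_leftLim_lt (ae_gain₁_eq hE hz₂) (t := 0)
    (by rwa [StieltjesFunction.leftLim_zero_of_neg S₁.F_neg])
  rw [← h1.2, StieltjesFunction.leftLim_zero_of_neg S₂.F_neg]

/-- Otherwise player 1 would not concede at `0`, and `hsmall` keeps his challenges below mass one,
so he would concede later, waiting for an opponent with no concession left to make. -/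
lemma F₂_zero_lt_one (hsmall : P.k₂ * z₁ < (1 - P.w₁ - P.k₂) * (1 - z₁)) : S₂.F 0 < 1 := by
  by_contra! hge
  have h1 : S₂.F 0 = 1 := le_antisymm (S₂.F_le_one 0) hge
  have h2 : S₁.F 0 = 0 := by
    by_contra h
    have := not_both_concede_at_zero hE hz₂
      (lt_of_le_of_ne (StieltjesFunction.nonneg_of_neg S₁.F_neg 0) (Ne.symm h))
    linarith
  -- A negative time makes the bound cover the whole mass, including time `0`.
  have h3 := G_mass_sub_le hE hz₁ hz₂ (-1)
  rw [S₁.G_neg (-1) (by norm_num), arrivalDistribution_of_neg _ _ (by norm_num : (-1 : ℝ) < 0)] at h3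
  have h4 : S₁.G.measure.real univ < 1 := by
    by_contra! h
    have hα : 0 < (1 - P.w₁ - P.k₂) * (1 - z₁) :=
      mul_pos (by linarith [P.k₂_lt]) (sub_pos.2 hz₁.2)
    nlinarith [mul_le_mul_of_nonneg_left h hα.le]
  have h5 := (best_response₁ hE hz₂).2.2
  have h6 := StieltjesFunction.measureReal_Ioi_eq S₁.F_neg le_rfl
  have h7 : S₁.F.measure (Ioi 0) ≠ 0 := fun h => by
    rw [measureReal_def, h, h2] at h6
    simp at h6
    linarith
  have h8 := StieltjesFunction.measureReal_Ioi_eq S₂.F_neg le_rfl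
  rw [(best_response₂ hE hz₁).2, h1, sub_self, measureReal_eq_zero_iff] at h8
  exact mass₂_of_mass₁ hE hz₂ le_rfl h7 h8

/-- As long as player 2 may still concede, both players are indifferent. -/
lemma gains_eq_of_F₂_lt_one (ht : 0 ≤ t) (hF : S₂.F t < 1) :
    P.gain₁ z₂ S₂ t = P.maxGain₁ z₂ S₁ S₂ ∧
      P.gain₂ z₁ S₁ t = P.maxGain₂ z₁ S₁ S₂ := by
  have h2 := measure_Ioi₂_ne_zero hE hz₁ ht hF
  exact ⟨gain₁_eq_of_mass hE hz₁ hz₂ ht (mass₁_of_mass₂ hE hz₁ hz₂ ht h2),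
    gain₂_eq_of_mass hE hz₁ hz₂ ht h2⟩

omit hE hz₁ in
lemma exp_rate₂_of_gain₁_const {T : ℝ} (hT : 0 ≤ T)
    (h : ∀ t ∈ Icc 0 T, P.gain₁ z₂ S₂ t = (1 - z₂) * S₂.F 0) :
    Real.exp (P.rate₂ * T) * (1 - (1 - z₂) * S₂.F T) = 1 - (1 - z₂) * S₂.F 0 := by
  have := integral_exp_of_waitingGain_const (Γ := fun _ => 0)
    (S₂.F.mono.const_mul (sub_nonneg.2 hz₂.2.le)) continuous_const (survival₂_anti hz₂.2.le)
    (fun _ => rfl) hT h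
  simpa using this

/-- Concessions end at a finite time `T`, until which both players are indifferent. -/
lemma exists_end_time (hsmall : P.k₂ * z₁ < (1 - P.w₁ - P.k₂) * (1 - z₁)) :
    ∃ T, 0 < T ∧ S₂.F T = 1 ∧ ∀ t ∈ Icc 0 T,
      P.gain₁ z₂ S₂ t = P.maxGain₁ z₂ S₁ S₂ ∧ P.gain₂ z₁ S₁ t = P.maxGain₂ z₁ S₁ S₂ := by
  have hF0 := F₂_zero_lt_one hE hz₁ hz₂ hsmall
  set K : Set ℝ := {t | 0 ≤ t ∧ S₂.F t = 1} with hK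
  have hKb : BddBelow K := ⟨0, fun t ht => ht.1⟩
  have hKne : K.Nonempty := by
    -- Chosen so that `exp (rate₂ * t₀) = e / z₂`: indifference up to `t₀` would push the survival
    -- probability of player 2 below `z₂`.
    set t₀ := (Real.log z₂⁻¹ + 1) / P.rate₂ with ht₀
    have hlog : 0 < Real.log z₂⁻¹ + 1 := by
      linarith [Real.log_nonneg ((one_le_inv₀ hz₂.1).2 hz₂.2.le)]
    have ht₀0 : 0 ≤ t₀ := div_nonneg hlog.le P.rate₂_pos.le
    refine ⟨t₀, ht₀0, ?_⟩
    by_contra h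
    have hlt : S₂.F t₀ < 1 := lt_of_le_of_ne (S₂.F_le_one _) h
    have hg0 := (gains_eq_of_F₂_lt_one hE hz₁ hz₂ le_rfl hF0).1
    have h1 := exp_rate₂_of_gain₁_const (P := P) (S₂ := S₂) hz₂ ht₀0 fun t ht => by
      rw [(gains_eq_of_F₂_lt_one hE hz₁ hz₂ ht.1 ((S₂.F.mono ht.2).trans_lt hlt)).1, ← hg0, gain₁,
        waitingGain_zero]
    have h2 : P.rate₂ * t₀ = Real.log z₂⁻¹ + 1 := mul_div_cancel₀ _ P.rate₂_pos.ne'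
    rw [h2, Real.exp_add, Real.exp_log (inv_pos.2 hz₂.1)] at h1
    have h3 : z₂ ≤ 1 - (1 - z₂) * S₂.F t₀ := by nlinarith [S₂.F_le_one t₀, hz₂.2]
    have h4 := survival₂_le_one (S₂ := S₂) hz₂.2.le 0
    have h5 : z₂⁻¹ * Real.exp 1 * z₂ = Real.exp 1 := by
      field_simp [hz₂.1.ne']
    have h6 : z₂⁻¹ * Real.exp 1 * z₂ ≤ z₂⁻¹ * Real.exp 1 * (1 - (1 - z₂) * S₂.F t₀) :=
      mul_le_mul_of_nonneg_left h3 (mul_nonneg (inv_nonneg.2 hz₂.1.le) (Real.exp_pos 1).le)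
    linarith [Real.add_one_lt_exp one_ne_zero]
  set T := sInf K with hT
  have hT0 : 0 ≤ T := le_csInf hKne fun t ht => ht.1
  have hFT : S₂.F T = 1 := by
    refine tendsto_nhds_unique ((S₂.F.right_continuous T).tendsto.mono_left
      (nhdsWithin_mono _ Ioi_subset_Ici_self)) (tendsto_const_nhds.congr' ?_)
    filter_upwards [self_mem_nhdsWithin] with s hs
    obtain ⟨x, hx, hxs⟩ := exists_lt_of_csInf_lt hKne (mem_Ioi.1 hs)
    exact le_antisymm (hx.2 ▸ S₂.F.mono hxs.le) (S₂.F_le_one s)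
  have hTpos : 0 < T := lt_of_le_of_ne hT0 fun h => by rw [← h] at hFT; linarith
  have hlt : ∀ t ∈ Ico 0 T, S₂.F t < 1 := fun t ht =>
    lt_of_le_of_ne (S₂.F_le_one t) fun h => absurd (csInf_le hKb ⟨ht.1, h⟩) (not_le.2 ht.2)
  have hg := fun t (ht : t ∈ Ico 0 T) => gains_eq_of_F₂_lt_one hE hz₁ hz₂ ht.1 (hlt t ht)
  refine ⟨T, hTpos, hFT, fun t ht => ?_⟩
  rcases ht.2.lt_or_eq with h | rfl
  · exact hg t ⟨ht.1, h⟩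
  · exact ⟨waitingGain_eq_at_end P.r₁_pos P.rate₂_pos (S₂.F.mono.const_mul (sub_nonneg.2 hz₂.2.le))
        (survival₂_anti hz₂.2.le) (fun t _ => survival₂_le_one hz₂.2.le t) hTpos
        (fun t ht => (hg t ht).1) (gain₁_le_maxGain₁ hE hz₂ ht.1),
      waitingGain_eq_at_end P.r₂_pos P.rate₁_pos (S₁.F.mono.const_mul (sub_nonneg.2 hz₁.2.le))
        (survival₁_anti (P := P) (S₁ := S₁) hz₁.1.le hz₁.2.le)
        (fun t _ => survival₁_le_one hz₁.1.le hz₁.2.le t) hTpos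
        (fun t ht => (hg t ht).2) (gain₂_le_maxGain₂ hE hz₁ ht.1)⟩

/-- After the end of concessions, the survival probability of player 1 is of the order of the
probability that she is justified and has not challenged. -/
lemma survival₁_le_of_F₂_eq_one {T : ℝ} (hT : 0 ≤ T) (hFT : S₂.F T = 1) :
    P.survival₁ z₁ S₁ T ≤
      P.challengeRatio * z₁ * (1 - arrivalDistribution P.γ₁ P.γ₁_nonneg T) := by
  have h1 := StieltjesFunction.measureReal_Ioi_eq S₂.F_neg hT
  rw [(best_response₂ hE hz₁).2, hFT, sub_self, measureReal_eq_zero_iff] at h1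
  have h2 : S₁.F.measure (Ioi T) = 0 := by
    by_contra h
    exact mass₂_of_mass₁ hE hz₂ hT h h1
  have h3 := StieltjesFunction.measureReal_Ioi_eq S₁.F_neg hT
  rw [measureReal_def, h2, ENNReal.toReal_zero] at h3
  have h4 := (best_response₁ hE hz₂).2.2
  have h5 := G_mass_sub_le hE hz₁ hz₂ T
  have hp : 0 < 1 - P.w₁ - P.k₂ := by linarith [P.k₂_lt]
  have h6 : S₁.F T = 1 - S₁.G.measure.real univ := by linarith
  rw [challengeRatio, div_mul_eq_mul_div, div_mul_eq_mul_div, le_div_iff₀ hp, survival₁,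
    challenged₁, h6]
  linarith

/-- The probability that player 1 does not concede at time `0`, by the length `T` of the war of
attrition. -/
lemma no_concession₁_bounds {T : ℝ} (hT : 0 < T) (hFT : S₂.F T = 1)
    (hg : ∀ t ∈ Icc 0 T, P.gain₂ z₁ S₁ t = (1 - z₁) * S₁.F 0) :
    z₁ * Real.exp ((P.rate₁ - P.γ₁) * T) ≤ 1 - (1 - z₁) * S₁.F 0 ∧
    1 - (1 - z₁) * S₁.F 0 ≤ P.challengeRatio * z₁ *
      (1 + P.rate₁ * ∫ x in (0 : ℝ)..T, Real.exp ((P.rate₁ - P.γ₁) * x)) := by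
  set l := P.rate₁ with hl
  have hl0 : 0 < l := P.rate₁_pos
  set H := arrivalDistribution P.γ₁ P.γ₁_nonneg with hH
  set Γ := P.challenged₁ z₁ S₁ with hΓ
  set C := P.challengeRatio * z₁ with hC
  have hHc : Continuous H := arrivalDistribution_continuous P.γ₁_nonneg
  have hΓc : Continuous Γ :=
    ((G_continuous hE hz₁ hz₂).const_mul _).add (hHc.const_mul _)
  have hode := integral_exp_of_waitingGain_const (Γ := Γ)
    (S₁.F.mono.const_mul (sub_nonneg.2 hz₁.2.le)) hΓc (survival₁_anti hz₁.1.le hz₁.2.le)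
    (fun _ => rfl) hT.le hg
  have hint : ∀ c : ℝ, ∫ x in (0 : ℝ)..T, Real.exp (l * x) * (l * c) = c * (Real.exp (l * T) - 1) :=
    fun c => by
      have h := integral_mul_exp (-l) 0 T
      simp only [neg_neg, mul_zero, Real.exp_zero] at h
      have h2 : ∀ x, Real.exp (l * x) * (l * c) = -c * (Real.exp (l * x) * -l) := fun x => by ring
      simp_rw [h2]
      rw [intervalIntegral.integral_const_mul, h]
      ring
  -- This form of the solution has only nonnegative terms, each at most `C` times its value for
  -- justified types. Dropping the `Γ` terms gives the lower bound; inserting the `C` bounds makes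
  -- the `exp (l * T)` terms cancel and leaves the upper one.
  have hdec : 1 - (1 - z₁) * S₁.F 0 = Real.exp (l * T) * P.survival₁ z₁ S₁ T + Γ T
      + ∫ x in (0 : ℝ)..T, Real.exp (l * x) * (l * (Γ T - Γ x)) := by
    have h1 : ∀ x, Real.exp (l * x) * (l * (Γ T - Γ x)) =
        Real.exp (l * x) * (l * Γ T) - Real.exp (l * x) * (l * Γ x) := fun x => by ring
    simp_rw [h1]
    rw [intervalIntegral.integral_sub (Continuous.intervalIntegrable (by fun_prop) _ _)
      (Continuous.intervalIntegrable (by fun_prop) _ _), hint, survival₁]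
    linarith
  have hHT : 1 - H T = Real.exp (-P.γ₁ * T) := by
    rw [hH, arrivalDistribution_of_nonneg _ hT.le]; ring
  constructor
  · have h1 := survival₁_ge (P := P) (S₁ := S₁) hz₁.2.le T
    rw [← hH, hHT] at h1
    have h2 := challenged₁_nonneg (P := P) (S₁ := S₁) hz₁.1.le hz₁.2.le T
    have h3 : 0 ≤ ∫ x in (0 : ℝ)..T, Real.exp (l * x) * (l * (Γ T - Γ x)) :=
      intervalIntegral.integral_nonneg hT.le fun x hx => mul_nonneg (Real.exp_pos _).le
        (mul_nonneg hl0.le (sub_nonneg.2 (challenged₁_mono hz₁.1.le hz₁.2.le hx.2)))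
    have h4 : Real.exp ((l - P.γ₁) * T) = Real.exp (l * T) * Real.exp (-P.γ₁ * T) := by
      rw [← Real.exp_add]; congr 1; ring
    have h5 := mul_le_mul_of_nonneg_left h1 (Real.exp_pos (l * T)).le
    rw [hdec, h4]
    linarith
  · have h1 := mul_le_mul_of_nonneg_left (survival₁_le_of_F₂_eq_one hE hz₁ hz₂ hT.le hFT)
      (Real.exp_pos (l * T)).le
    have h2 : Γ T ≤ C * H T := by
      have h := challenged₁_sub_le hE hz₁ hz₂ (show (-1 : ℝ) ≤ T by linarith)
      have h0 : P.challenged₁ z₁ S₁ (-1) = 0 := by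
        rw [challenged₁, S₁.G_neg _ (by norm_num), arrivalDistribution_of_neg _ _ (by norm_num)]
        ring
      rwa [h0, arrivalDistribution_of_neg _ (-1) (by norm_num), sub_zero, sub_zero] at h
    have h3 : ∫ x in (0 : ℝ)..T, Real.exp (l * x) * (l * (Γ T - Γ x)) ≤
        ∫ x in (0 : ℝ)..T, Real.exp (l * x) * (l * (C * (H T - H x))) := by
      refine intervalIntegral.integral_mono_on hT.le
        (Continuous.intervalIntegrable (by fun_prop) _ _)
        (Continuous.intervalIntegrable (by fun_prop) _ _) fun x hx => ?_
      exact mul_le_mul_of_nonneg_left (mul_le_mul_of_nonneg_left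
        (challenged₁_sub_le hE hz₁ hz₂ hx.2) hl0.le) (Real.exp_pos _).le
    have h4 : ∫ x in (0 : ℝ)..T, Real.exp (l * x) * (l * (C * (H T - H x))) =
        C * l * (∫ x in (0 : ℝ)..T, Real.exp ((l - P.γ₁) * x))
          - C * (1 - H T) * (Real.exp (l * T) - 1) := by
      rw [← hint, ← intervalIntegral.integral_const_mul, ← intervalIntegral.integral_sub
        (Continuous.intervalIntegrable (by fun_prop) _ _)
        (Continuous.intervalIntegrable (by fun_prop) _ _)]
      refine intervalIntegral.integral_congr fun x hx => ?_
      rw [uIcc_of_le hT.le] at hx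
      have h5 : Real.exp ((l - P.γ₁) * x) = Real.exp (l * x) * Real.exp (-P.γ₁ * x) := by
        rw [← Real.exp_add]; congr 1; ring
      have h6 : H x = 1 - Real.exp (-P.γ₁ * x) := arrivalDistribution_of_nonneg _ hx.1
      simp only [h5, h6]
      ring
    rw [hdec]
    linarith

/-- The structure of an equilibrium: if justified challenges are rare, then concessions end at a
finite time `T` which governs the probabilities of an initial concession. -/
theorem equilibrium_structure (hsmall : P.k₂ * z₁ < (1 - P.w₁ - P.k₂) * (1 - z₁)) :
    ∃ T, 0 < T ∧ ∃ x₁ x₂ : ℝ, 0 ≤ x₁ ∧ 0 ≤ x₂ ∧ (0 < x₁ → x₂ = 0) ∧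
      P.payoff₁ z₂ S₁ S₂ = 1 - P.a₂ + P.D * x₂ ∧
      P.payoff₂ z₁ S₁ S₂ = 1 - P.a₁ + P.D * x₁ ∧
      z₂ * Real.exp (P.rate₂ * T) = 1 - x₂ ∧
      z₁ * Real.exp ((P.rate₁ - P.γ₁) * T) ≤ 1 - x₁ ∧
      1 - x₁ ≤ P.challengeRatio * z₁ *
        (1 + P.rate₁ * ∫ x in (0 : ℝ)..T, Real.exp ((P.rate₁ - P.γ₁) * x)) := by
  obtain ⟨T, hT, hFT, hg⟩ := exists_end_time hE hz₁ hz₂ hsmall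
  have h0 := hg 0 ⟨le_rfl, hT.le⟩
  have hg₁ : ∀ t ∈ Icc 0 T, P.gain₁ z₂ S₂ t = (1 - z₂) * S₂.F 0 := fun t ht => by
    rw [(hg t ht).1, ← h0.1, gain₁, waitingGain_zero]
  have hg₂ : ∀ t ∈ Icc 0 T, P.gain₂ z₁ S₁ t = (1 - z₁) * S₁.F 0 := fun t ht => by
    rw [(hg t ht).2, ← h0.2, gain₂, waitingGain_zero]
  have hp₁ := h0.1
  have hp₂ := h0.2
  rw [hg₁ 0 ⟨le_rfl, hT.le⟩, maxGain₁, eq_div_iff P.D_pos.ne'] at hp₁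
  rw [hg₂ 0 ⟨le_rfl, hT.le⟩, maxGain₂, eq_div_iff P.D_pos.ne'] at hp₂
  have hend := exp_rate₂_of_gain₁_const hz₂ hT.le hg₁
  rw [hFT] at hend
  have hbounds := no_concession₁_bounds hE hz₁ hz₂ hT hFT hg₂
  refine ⟨T, hT, (1 - z₁) * S₁.F 0, (1 - z₂) * S₂.F 0,
    mul_nonneg (sub_nonneg.2 hz₁.2.le) (StieltjesFunction.nonneg_of_neg S₁.F_neg 0),
    mul_nonneg (sub_nonneg.2 hz₂.2.le) (StieltjesFunction.nonneg_of_neg S₂.F_neg 0),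
    fun h => ?_, by linarith, by linarith, by linarith, hbounds.1, hbounds.2⟩
  rw [not_both_concede_at_zero hE hz₂ (pos_of_mul_pos_right h (sub_nonneg.2 hz₁.2.le)), mul_zero]

end UltimatumBargaining

/-! ### Asymptotics as the priors vanish. -/

/-- The hypothesis bounds `T` by `-log z / c`. The bound separates the ratio of the priors, which
converges, from a power of `z` that vanishes in the limit when `d < c`. -/
lemma mul_exp_le_of_mul_exp_le_one {y z c d T : ℝ} (hy : 0 ≤ y) (hz : 0 < z) (hc : 0 < c)
    (hd : 0 ≤ d) (h : z * Real.exp (c * T) ≤ 1) :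
    y * Real.exp (d * T) ≤ y / z * z ^ (1 - d / c) := by
  have h1 : c * T ≤ -Real.log z := by
    have h2 := Real.log_le_log (mul_pos hz (Real.exp_pos _)) h
    rw [Real.log_mul hz.ne' (Real.exp_pos _).ne', Real.log_exp, Real.log_one] at h2
    linarith
  have h2 : d * T ≤ Real.log z * (-(d / c)) := by
    have h3 := mul_le_mul_of_nonneg_left h1 (div_nonneg hd hc.le)
    have h4 : d / c * (c * T) = d * T := by field_simp
    linarith
  have h3 : z ^ (1 - d / c) = z * Real.exp (Real.log z * (-(d / c))) := by
    rw [sub_eq_add_neg, Real.rpow_add hz, Real.rpow_one, Real.rpow_def_of_pos hz]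
  rw [h3, ← mul_assoc, div_mul_cancel₀ _ hz.ne']
  exact mul_le_mul_of_nonneg_left (Real.exp_le_exp.2 h2) hy

lemma tendsto_div_mul_rpow {y z : ℕ → ℝ} {L p : ℝ} (hp : 0 < p) (hz : Tendsto z atTop (𝓝 0))
    (hL : Tendsto (fun n => y n / z n) atTop (𝓝 L)) :
    Tendsto (fun n => y n / z n * z n ^ p) atTop (𝓝 0) := by
  have h := hL.mul (hz.rpow_const (p := p) (Or.inr hp.le))
  rwa [Real.zero_rpow hp.ne', mul_zero] at h

lemma integral_exp_mul_le {ρ T : ℝ} (hρ : 0 < ρ) :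
    ∫ x in (0 : ℝ)..T, Real.exp (ρ * x) ≤ Real.exp (ρ * T) / ρ := by
  have h := integral_mul_exp (-ρ) 0 T
  rw [intervalIntegral.integral_mul_const] at h
  simp only [neg_neg, mul_zero, Real.exp_zero] at h
  rw [le_div_iff₀ hρ]
  linarith

lemma integral_exp_neg_mul_le {ρ T : ℝ} (hρ : 0 < ρ) :
    ∫ x in (0 : ℝ)..T, Real.exp (-ρ * x) ≤ 1 / ρ := by
  have h := integral_mul_exp ρ 0 T
  rw [intervalIntegral.integral_mul_const, mul_zero, Real.exp_zero] at h
  rw [le_div_iff₀ hρ]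
  linarith [Real.exp_pos (-ρ * T)]

namespace UltimatumBargaining

lemma challengeRatio_pos (P : UltimatumBargaining) : 0 < P.challengeRatio :=
  div_pos (by linarith [P.k₂_lt, P.k₂_pos]) (by linarith [P.k₂_lt])

/-- Equilibrium payoffs in terms of the end time `T` of concessions and of the probabilities
`x₁`, `x₂` of an initial concession, for small probabilities of player 1 being justified. -/
lemma eventually_equilibrium_structure {P : UltimatumBargaining} {z₁ z₂ u₁ u₂ : ℕ → ℝ}
    (hz₁ : ∀ n, 0 < z₁ n ∧ z₁ n < 1) (hz₂ : ∀ n, 0 < z₂ n ∧ z₂ n < 1)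
    (hlim₁ : Tendsto z₁ atTop (𝓝 0))
    (hu : ∀ n, P.IsEquilibriumPayoff (z₁ n) (z₂ n) (u₁ n) (u₂ n)) :
    ∃ T x₁ x₂ : ℕ → ℝ, ∀ᶠ n in atTop,
      0 < T n ∧ 0 ≤ x₁ n ∧ 0 ≤ x₂ n ∧ (0 < x₁ n → x₂ n = 0) ∧
      u₁ n = 1 - P.a₂ + P.D * x₂ n ∧ u₂ n = 1 - P.a₁ + P.D * x₁ n ∧
      z₂ n * Real.exp (P.rate₂ * T n) = 1 - x₂ n ∧
      z₁ n * Real.exp ((P.rate₁ - P.γ₁) * T n) ≤ 1 - x₁ n ∧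
      1 - x₁ n ≤ P.challengeRatio * z₁ n *
        (1 + P.rate₁ * ∫ x in (0 : ℝ)..T n, Real.exp ((P.rate₁ - P.γ₁) * x)) := by
  have hsmall : ∀ᶠ n in atTop, P.k₂ * z₁ n < (1 - P.w₁ - P.k₂) * (1 - z₁ n) := by
    refine (hlim₁.const_mul P.k₂).eventually_lt ((hlim₁.const_sub 1).const_mul _) ?_
    linarith [P.k₂_lt]
  have h : ∀ n, ∃ T x₁ x₂ : ℝ, P.k₂ * z₁ n < (1 - P.w₁ - P.k₂) * (1 - z₁ n) →
      0 < T ∧ 0 ≤ x₁ ∧ 0 ≤ x₂ ∧ (0 < x₁ → x₂ = 0) ∧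
      u₁ n = 1 - P.a₂ + P.D * x₂ ∧ u₂ n = 1 - P.a₁ + P.D * x₁ ∧
      z₂ n * Real.exp (P.rate₂ * T) = 1 - x₂ ∧
      z₁ n * Real.exp ((P.rate₁ - P.γ₁) * T) ≤ 1 - x₁ ∧
      1 - x₁ ≤ P.challengeRatio * z₁ n *
        (1 + P.rate₁ * ∫ x in (0 : ℝ)..T, Real.exp ((P.rate₁ - P.γ₁) * x)) := fun n => by
    by_cases hn : P.k₂ * z₁ n < (1 - P.w₁ - P.k₂) * (1 - z₁ n)
    · obtain ⟨S₁, S₂, hE, h₁, h₂⟩ := hu n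
      obtain ⟨T, hT, x₁, x₂, h⟩ := equilibrium_structure hE (hz₁ n) (hz₂ n) hn
      rw [← h₁, ← h₂] at h
      exact ⟨T, x₁, x₂, fun _ => ⟨hT, h⟩⟩
    · exact ⟨0, 0, 0, fun h => absurd h hn⟩
  choose T x₁ x₂ h using h
  exact ⟨T, x₁, x₂, hsmall.mono h⟩

end UltimatumBargaining

end

theorem mainTheorem3 (P : UltimatumBargaining) (z₁ z₂ : ℕ → ℝ)
    (hz₁ : ∀ n, 0 < z₁ n ∧ z₁ n < 1) (hz₂ : ∀ n, 0 < z₂ n ∧ z₂ n < 1)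
    (hlim₁ : Tendsto z₁ atTop (𝓝 0)) (hlim₂ : Tendsto z₂ atTop (𝓝 0))
    (u₁ u₂ : ℕ → ℝ)
    (hu : ∀ n, P.IsEquilibriumPayoff (z₁ n) (z₂ n) (u₁ n) (u₂ n)) :
    ((P.rate₁ < P.γ₁ ∨
        (P.γ₁ ≤ P.rate₁ ∧ P.rate₁ < P.γ₁ + P.rate₂ ∧
          ∃ L : ℝ, 0 < L ∧ Tendsto (fun n => z₁ n / z₂ n) atTop (𝓝 L))) →
      Tendsto u₁ atTop (𝓝 (1 - P.a₂)) ∧ Tendsto u₂ atTop (𝓝 P.a₂)) ∧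
    ((P.γ₁ + P.rate₂ < P.rate₁ ∧
          ∃ L : ℝ, 0 < L ∧ Tendsto (fun n => z₁ n / z₂ n) atTop (𝓝 L)) →
      Tendsto u₁ atTop (𝓝 P.a₁) ∧ Tendsto u₂ atTop (𝓝 (1 - P.a₁))) := by
  obtain ⟨T, x₁, x₂, h⟩ :=
    UltimatumBargaining.eventually_equilibrium_structure hz₁ hz₂ hlim₁ hu
  have hC := P.challengeRatio_pos
  have hr₁ := P.rate₁_pos
  have hr₂ := P.rate₂_pos
  constructor
  · intro hcase
    obtain ⟨δ, hδ, hle⟩ : ∃ δ : ℕ → ℝ, Tendsto δ atTop (𝓝 0) ∧ ∀ᶠ n in atTop, 1 - x₁ n ≤ δ n := by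
      rcases hcase with hlt | ⟨hge, hlt, L, -, hL⟩
      · have hρ := sub_pos.2 hlt
        refine ⟨fun n => P.challengeRatio * z₁ n * (1 + P.rate₁ * (1 / (P.γ₁ - P.rate₁))), ?_, ?_⟩
        · simpa using (hlim₁.const_mul P.challengeRatio).mul_const
            (1 + P.rate₁ * (1 / (P.γ₁ - P.rate₁)))
        · filter_upwards [h] with n hn
          refine hn.2.2.2.2.2.2.2.2.trans (mul_le_mul_of_nonneg_left ?_
            (mul_nonneg hC.le (hz₁ n).1.le))
          rw [← neg_sub P.γ₁]
          linarith [mul_le_mul_of_nonneg_left (integral_exp_neg_mul_le (T := T n) hρ) hr₁.le]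
      -- A rate strictly between `λ₁ - γ₁` and `λ₂`; it is positive even if `λ₁ = γ₁`, where the
      -- integral equals `T`.
      · set ρ := (P.rate₁ - P.γ₁ + P.rate₂) / 2 with hρdef
        have hρ : 0 < ρ := by linarith
        have hρ₁ : P.rate₁ - P.γ₁ ≤ ρ := by linarith
        have hρ₂ : 0 < 1 - ρ / P.rate₂ := sub_pos.2 ((div_lt_one hr₂).2 (by linarith))
        refine ⟨fun n => P.challengeRatio * (z₁ n + P.rate₁ / ρ *
          (z₁ n / z₂ n * z₂ n ^ (1 - ρ / P.rate₂))), ?_, ?_⟩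
        · simpa using (hlim₁.add ((tendsto_div_mul_rpow hρ₂ hlim₂ hL).const_mul
            (P.rate₁ / ρ))).const_mul P.challengeRatio
        · filter_upwards [h] with n hn
          have h1 : z₂ n * Real.exp (P.rate₂ * T n) ≤ 1 := by
            linarith [hn.2.2.2.2.2.2.1, hn.2.2.1]
          have h2 := mul_exp_le_of_mul_exp_le_one (hz₁ n).1.le (hz₂ n).1 hr₂ hρ.le h1
          have h3 : ∫ x in (0 : ℝ)..T n, Real.exp ((P.rate₁ - P.γ₁) * x) ≤
              ∫ x in (0 : ℝ)..T n, Real.exp (ρ * x) :=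
            intervalIntegral.integral_mono_on hn.1.le
              (Continuous.intervalIntegrable (by fun_prop) _ _)
              (Continuous.intervalIntegrable (by fun_prop) _ _) fun x hx =>
                Real.exp_le_exp.2 (mul_le_mul_of_nonneg_right hρ₁ hx.1)
          have h4 := mul_le_mul_of_nonneg_left (h3.trans (integral_exp_mul_le hρ)) hr₁.le
          refine hn.2.2.2.2.2.2.2.2.trans ?_
          rw [mul_assoc]
          refine mul_le_mul_of_nonneg_left ?_ hC.le
          have h5 := mul_le_mul_of_nonneg_left h4 (hz₁ n).1.le
          have h6 := mul_le_mul_of_nonneg_left h2 (div_nonneg hr₁.le hρ.le)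
          have h7 : z₁ n * (P.rate₁ * (Real.exp (ρ * T n) / ρ)) =
              P.rate₁ / ρ * (z₁ n * Real.exp (ρ * T n)) := by ring
          linarith
    have hx₁ : Tendsto x₁ atTop (𝓝 1) := by
      have h1 : Tendsto (fun n => 1 - x₁ n) atTop (𝓝 0) :=
        tendsto_of_tendsto_of_tendsto_of_le_of_le' tendsto_const_nhds hδ
          (h.mono fun n hn => (mul_pos (hz₁ n).1 (Real.exp_pos _)).le.trans hn.2.2.2.2.2.2.2.1) hle
      simpa using h1.const_sub 1
    constructor
    · refine tendsto_const_nhds.congr' ?_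
      -- Once `x₁ > 0`, player 2 makes no initial concession, so `u₁` is eventually equal to its
      -- limit.
      filter_upwards [h, hx₁.eventually_const_lt one_pos] with n hn hpos
      rw [hn.2.2.2.2.1, hn.2.2.2.1 hpos]
      ring
    · have h1 : Tendsto (fun n => 1 - P.a₁ + P.D * x₁ n) atTop (𝓝 (1 - P.a₁ + P.D * 1)) :=
        (hx₁.const_mul P.D).const_add _
      have h2 : 1 - P.a₁ + P.D * 1 = P.a₂ := by rw [UltimatumBargaining.D]; ring
      rw [h2] at h1
      exact h1.congr' (h.mono fun n hn => hn.2.2.2.2.2.1.symm)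
  · rintro ⟨hgt, L, hL0, hL⟩
    have hρ : 0 < P.rate₁ - P.γ₁ := by linarith
    have hρ₂ : 0 < 1 - P.rate₂ / (P.rate₁ - P.γ₁) := sub_pos.2 ((div_lt_one hρ).2 (by linarith))
    have hL' : Tendsto (fun n => z₂ n / z₁ n) atTop (𝓝 L⁻¹) := by
      simpa using hL.inv₀ hL0.ne'
    -- The roles are exchanged: `z₁ exp((λ₁ - γ₁) T) ≤ 1` now bounds `T`, and `λ₂ < λ₁ - γ₁` makes
    -- the power of `z₁` vanish.
    have hx₂ : Tendsto x₂ atTop (𝓝 1) := by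
      have h1 : Tendsto (fun n => 1 - x₂ n) atTop (𝓝 0) := by
        refine tendsto_of_tendsto_of_tendsto_of_le_of_le' tendsto_const_nhds
          (tendsto_div_mul_rpow hρ₂ hlim₁ hL') ?_ ?_
        · filter_upwards [h] with n hn
          rw [← hn.2.2.2.2.2.2.1]
          exact (mul_pos (hz₂ n).1 (Real.exp_pos _)).le
        · filter_upwards [h] with n hn
          rw [← hn.2.2.2.2.2.2.1]
          exact mul_exp_le_of_mul_exp_le_one (hz₂ n).1.le (hz₁ n).1 hρ hr₂.le
            (by linarith [hn.2.2.2.2.2.2.2.1, hn.2.1])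
      simpa using h1.const_sub 1
    constructor
    · have h1 : Tendsto (fun n => 1 - P.a₂ + P.D * x₂ n) atTop (𝓝 (1 - P.a₂ + P.D * 1)) :=
        (hx₂.const_mul P.D).const_add _
      have h2 : 1 - P.a₂ + P.D * 1 = P.a₁ := by rw [UltimatumBargaining.D]; ring
      rw [h2] at h1
      exact h1.congr' (h.mono fun n hn => hn.2.2.2.2.1.symm)
    · refine tendsto_const_nhds.congr' ?_
      filter_upwards [h, hx₂.eventually_const_lt one_pos] with n hn hpos
      have h0 : x₁ n = 0 := le_antisymm (not_lt.1 fun h1 => hpos.ne' (hn.2.2.2.1 h1)) hn.2.1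
      rw [hn.2.2.2.2.2.1, h0]
      ring
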